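/- Let $M,N,K$ be positive integers with $MN=K$, let $\Delta f>0$, $T=1/\Delta f$, $B=K\Delta f$, $\mathrm{sinc}(x)=\sin(\pi x)/(\pi x)$, and let $$w_3(t)=\sqrt B\,\mathrm{sinc}(Bt)\,e^{j\pi(B-\frac1T)t},\qquad W_4(t)=\tfrac1{\sqrt T}\ (0\le t<T),\quad W_4(t)=0\ \text{otherwise}.$$ For a received signal $r\in L^2(\mathbb R)$ put $y(t)=W_4(t)\,[w_3\star r](t)$ ($\star$ is convolution) and $y[n]=\sqrt T\,y(n/B)$, $n\in\mathbb Z$. The CP-OFDM demodulator with $K$ sub-carriers outputs $$Y[i]=\frac1{\sqrt K}\sum_{n=0}^{K-1}y[n]\,e^{-j2\pi ni/K},\qquad i\in\mathbb Z.$$ 1. The delay period $\tau_p$ and the Doppler period $\nu_p$ determined by $\tau_p\nu_p=1$, $B\tau_p=M$, $T\nu_p=N$ are $\nu_p=N/T=N\Delta f$ and $\tau_p=1/\nu_p=M/B$. 2. $y(t)=0$ for $t\notin[0,T)$; hence $\sum_{p\in\mathbb Z}y[n+pMN]=y[n]$ for $0\le n<MN$, so that no periodization of the samples is needed. 3. Consider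 the Zak-OTFS demodulator with delay period $\tau_p=M/B$ and delay-Doppler matched filter $$w_{rx}(\tau,\nu)=w_3(\tau)\,w_4(\nu)\,e^{j2\pi\nu\tau},\qquad w_4(\nu)=\sqrt T\,\mathrm{sinc}(\nu T)\,e^{-j\pi\nu T}.$$ That is, let $$r_{dd}(\tau,\nu)=\sqrt{\tau_p}\sum_{n\in\mathbb Z}r(\tau+n\tau_p)e^{-j2\pi n\nu\tau_p},$$ $$y_{dd}(\tau,\nu)=\iint w_{rx}(\tau',\nu')\,r_{dd}(\tau-\tau',\nu-\nu')\,e^{j2\pi\nu'(\tau-\tau')}\,d\tau'\,d\nu',$$ where the series, and the double integral as the limit of its restrictions to $[-a,a]\times[-b,b]$ for $a,b\to\infty$, are taken in mean square on compact sets of $(\tau,\nu)$, and let $y_{dd}[k,l]=y_{dd}(k/B,l/T)$, $k,l\in\mathbb Z$, where the point values are those of the version of $y_{dd}$ that is continuous in $(\tau,\nu)$ from the right in $\tau$. This demodulator is well defined (both limits and that version exist, and the output is unique), and its output is the discrete frequency Zak transform (DFZT) of the CP-OFDM output: $$y_{dd}[k,l]=\frac1{\sqrt M}\sum_{p=0}^{M-1}Y[l+pN]\,e^{j2\pi(l+pN)\frac{k}{MN}}\qquad\text{for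 all }k,l\in\mathbb Z.$$ -/

import Mathlib

open MeasureTheory Filter Topology

noncomputable section

/-- The complex exponential `e^{j 2 π x}`. -/
def cis (x : ℝ) : ℂ := Complex.exp (2 * Real.pi * x * Complex.I)

/-- The normalized cardinal sine `sin (π x) / (π x)` (with value `1` at `0`). -/
def nsinc (x : ℝ) : ℝ := Real.sinc (Real.pi * x)

/-! ### The CP-OFDM demodulator -/

/-- The receive filter `w₃(t) = √B sinc(B t) e^{j π (B - 1/T) t}`. -/
def w3 (B T t : ℝ) : ℂ := (Real.sqrt B * nsinc (B * t) : ℝ) * cis ((B - 1 / T) * t / 2)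

/-- The rectangular receive window: `1/√T` on `[0, T)` and `0` elsewhere. -/
def W4 (T t : ℝ) : ℂ := (Set.Ico 0 T).indicator (fun _ => ((1 / Real.sqrt T : ℝ) : ℂ)) t

/-- The filtered and windowed signal `y(t) = W₄(t) [w₃ ⋆ r](t)`, `⋆` the linear convolution. -/
def rxSignal (B T : ℝ) (r : ℝ → ℂ) (t : ℝ) : ℂ :=
  W4 T t * convolution (w3 B T) r (ContinuousLinearMap.mul ℝ ℂ) volume t

/-- The samples `√T y(n/B)`, `n ∈ ℤ`. -/
def rxSample (B T : ℝ) (r : ℝ → ℂ) (n : ℤ) : ℂ :=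
  (Real.sqrt T : ℂ) * rxSignal B T r (n / B)

/-- `K`-point DFT: `Y[i] = (1/√K) ∑_{n=0}^{K-1} y[n] e^{-j 2 π n i / K}`, `i ∈ ℤ`. -/
def dft (K : ℕ) (y : ℤ → ℂ) (i : ℤ) : ℂ :=
  (1 / Real.sqrt K : ℝ) * ∑ n ∈ Finset.range K, y n * cis (-((n : ℝ) * i / K))

/-- The CP-OFDM demodulator with `K` sub-carriers: sinc filtering of bandwidth `B`, windowing over
`[0, T)`, sampling at rate `B`, `K`-point DFT. Its output is the sequence `Y[i]`. -/
def cpOfdmDemod (K : ℕ) (B T : ℝ) (r : ℝ → ℂ) : ℤ → ℂ := dft K (rxSample B T r)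

/-- Discrete frequency Zak transform:
`(1/√M) ∑_{p=0}^{M-1} Y[l + p N] e^{j 2 π (l + p N) k / (M N)}`, `k, l ∈ ℤ`. -/
def dfzt (M N : ℕ) (Y : ℤ → ℂ) (k l : ℤ) : ℂ :=
  (1 / Real.sqrt M : ℝ) *
    ∑ p ∈ Finset.range M, Y (l + p * N) * cis (((l : ℝ) + p * N) * k / (M * N))

/-! ### The Zak-OTFS demodulator

Delay-Doppler functions are functions of `(τ, ν) ∈ ℝ × ℝ`. -/

/-- Convergence in mean square on every compact set of the delay-Doppler plane. -/
def TendstoL2Loc {ι : Type*} (F : ι → ℝ × ℝ → ℂ) (f : Filter ι) (G : ℝ × ℝ → ℂ) : Prop :=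
  AEStronglyMeasurable G volume ∧
    ∀ S : Set (ℝ × ℝ), IsCompact S →
      Tendsto (fun i => eLpNorm (fun z => F i z - G z) 2 (volume.restrict S)) f (𝓝 0)

/-- `A` is the Zak transform with delay period `τp` of the finite-energy signal `a`:
`A(τ, ν) = √τp ∑_{n ∈ ℤ} a(τ + n τp) e^{-j 2 π n ν τp}`, the series being (unconditionally)
convergent in mean square on compact sets. -/
def IsZakTransform (τp : ℝ) (a : ℝ → ℂ) (A : ℝ × ℝ → ℂ) : Prop :=
  TendstoL2Loc
    (fun (s : Finset ℤ) z =>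
      (Real.sqrt τp : ℂ) * ∑ n ∈ s, a (z.1 + n * τp) * cis (-(n * z.2 * τp)))
    atTop A

/-- The twisted convolution integral restricted to delays `|τ'| ≤ R.1` and Dopplers
`|ν'| ≤ R.2`: `∬ w(τ', ν') A(τ - τ', ν - ν') e^{j 2 π ν' (τ - τ')} dτ' dν'`. -/
def twistedConvTrunc (w A : ℝ × ℝ → ℂ) (R : ℝ × ℝ) (z : ℝ × ℝ) : ℂ :=
  ∫ z' in Set.Icc (-R.1) R.1 ×ˢ Set.Icc (-R.2) R.2,
    w z' * A (z - z') * cis (z'.2 * (z.1 - z'.1))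

/-- `C = w *_σ A`: the twisted convolution, as an improper double integral that converges in mean
square on compact sets. (It is improper because sinc filters are not absolutely integrable and
Zak transforms do not decay.) -/
def IsTwistedConv (w A C : ℝ × ℝ → ℂ) : Prop :=
  TendstoL2Loc (twistedConvTrunc w A) (atTop ×ˢ atTop) C

/-- Continuity in `(τ, ν)`, from the right in the delay variable `τ`. Two such functions that agree
almost everywhere agree everywhere. -/
def DelayRightContinuous (C : ℝ × ℝ → ℂ) : Prop :=
  ∀ z : ℝ × ℝ, ContinuousWithinAt C (Set.Ici z.1 ×ˢ Set.univ) z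

/-- `ydd` is the output for the input `r` of the Zak-OTFS demodulator with delay period `τp` and
delay-Doppler matched filter `w`: Zak transform, twisted convolution with `w`, sampling on the
information lattice `{(k/B, l/T)}`. The twisted convolution is determined up to null sets only;
its point values are those of its version that is right-continuous in the delay, in accordance
with time windows over half-open intervals `[·, ·)`. -/
def IsZakOtfsDemod (B T τp : ℝ) (w : ℝ × ℝ → ℂ) (r : ℝ → ℂ) (ydd : ℤ → ℤ → ℂ) : Prop :=
  ∃ rdd Ydd : ℝ × ℝ → ℂ,
    IsZakTransform τp r rdd ∧ IsTwistedConv w rdd Ydd ∧ DelayRightContinuous Ydd ∧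
      ∀ k l : ℤ, ydd k l = Ydd ((k : ℝ) / B, (l : ℝ) / T)

/-- `w₄(ν) = √T sinc(ν T) e^{-j π ν T}`. -/
def w4 (T ν : ℝ) : ℂ := (Real.sqrt T * nsinc (ν * T) : ℝ) * cis (-(ν * T / 2))

/-- The matched filter `w_rx(τ, ν) = w₃(τ) w₄(ν) e^{j 2 π ν τ}`. -/
def wrx (B T : ℝ) (z : ℝ × ℝ) : ℂ := w3 B T z.1 * w4 T z.2 * cis (z.2 * z.1)

end

/-! The filter `wrx` is built so that twisted convolution acts on the signal behind a Zak transform.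
Apply it to a single term `r(τ + nτp) e^{-j2πnντp}` of the series and put `t = τ + nτp`: the phases
combine so that the double integral splits into `∫ w₃(u) r(t - u) du` times `∫ w₄(v) e^{j2πvt} dv`,
and the second factor is the window `W₄(t)`. Hence the output is the Zak transform of `y = W₄ · (w₃
⋆ r)`. Since `y` lives on `[0, T) = [0, Nτp)`, that transform is a locally finite sum. It is
continuous from the right in the delay, because `w₃ ⋆ r` is continuous and `W₄` is right-continuous.
On the information lattice it equals `(1/√N) ∑ₙ y[k + nM] e^{-j2πnl/N}`, and orthogonality of the
`M`-th roots of unity shows that the DFZT of the DFT is the same sum (`dfzt_dft`,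
`tsum_sample_eq_sum`).

The analytic difficulty is that neither sinc filter is absolutely integrable. With both integrals
truncated the splitting is exact (`twistedConvTrunc_zakSum`) and gives the Zak transform of
`truncSignal`. Partial Zak sums are bounded from `L²(ℝ)` to `L²` of a box, uniformly in the index
set (`eLpNorm_zakSum_le`), so it is enough that `truncSignal` tends to `rxSignal` in `L²`
(`tendsto_truncSignal`). Truncated Fourier integrals of a sinc are sums of two sine integrals: they
are uniformly bounded and converge to a rectangle off its edges. Dominated convergence then handles
the window. The same facts, read as Fourier multipliers through Plancherel, handle the convolution
with `w₃`.

Uniqueness follows because mean-square limits are determined almost everywhere and right-continuity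
in the delay fixes the point values. -/

/-! ### The sine integral -/

/-- The sine integral `∫₀ˣ sin t / t dt`. -/
noncomputable def sineIntegral (x : ℝ) : ℝ := ∫ t in (0 : ℝ)..x, Real.sinc t

theorem integrableOn_exp_neg_mul_Ioi {t : ℝ} (ht : 0 < t) :
    IntegrableOn (fun s : ℝ => Real.exp (-(s * t))) (Set.Ioi 0) := by
  have := integrableOn_exp_mul_Ioi (a := -t) (by linarith) 0
  refine this.congr_fun (fun s _ => ?_) measurableSet_Ioi
  ring_nf

theorem integral_exp_neg_mul_Ioi_zero {t : ℝ} (ht : 0 < t) :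
    ∫ s in Set.Ioi (0 : ℝ), Real.exp (-(s * t)) = 1 / t := by
  have := integral_exp_mul_Ioi (a := -t) (by linarith) 0
  simp only [mul_zero, Real.exp_zero] at this
  rw [show (1 / t : ℝ) = -1 / -t by rw [neg_div_neg_eq], ← this]
  congr 1; ext s; ring_nf

theorem integral_sin_mul_exp_neg (R s : ℝ) :
    ∫ t in (0 : ℝ)..R, Real.sin t * Real.exp (-(s * t)) =
      (1 + s ^ 2)⁻¹ - Real.exp (-(s * R)) * (Real.cos R + s * Real.sin R) * (1 + s ^ 2)⁻¹ := by
  have h : ∀ t : ℝ, HasDerivAt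
      (fun t => -(Real.exp (-(s * t)) * (Real.cos t + s * Real.sin t) * (1 + s ^ 2)⁻¹))
      (Real.sin t * Real.exp (-(s * t))) t := by
    intro t
    have h1 : HasDerivAt (fun t => Real.exp (-(s * t))) (Real.exp (-(s * t)) * (-s)) t := by
      simpa using ((hasDerivAt_id t).const_mul s).neg.exp
    have h2 : HasDerivAt (fun t => Real.cos t + s * Real.sin t) (-Real.sin t + s * Real.cos t) t :=
      (Real.hasDerivAt_cos t).add ((Real.hasDerivAt_sin t).const_mul s)
    refine ((h1.mul h2).mul_const _).neg.congr_deriv ?_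
    have : (1 + s ^ 2 : ℝ) ≠ 0 := by positivity
    field_simp
    ring
  rw [intervalIntegral.integral_eq_sub_of_hasDerivAt (fun t _ => h t)
    (Continuous.intervalIntegrable (by fun_prop) _ _)]
  simp
  ring

/-- Write `1/t = ∫₀^∞ e^{-st} ds` and exchange the integrals. Fubini applies because integrating the
absolute value over `s` first leaves `|sinc t|`, which is integrable on `(0, R]`. -/
theorem sineIntegral_eq {R : ℝ} (hR : 0 < R) :
    sineIntegral R = ∫ s in Set.Ioi (0 : ℝ), ((1 + s ^ 2)⁻¹ -
      Real.exp (-(s * R)) * (Real.cos R + s * Real.sin R) * (1 + s ^ 2)⁻¹) := by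
  have h1 : sineIntegral R =
      ∫ t in Set.Ioc 0 R, ∫ s in Set.Ioi (0 : ℝ), Real.sin t * Real.exp (-(s * t)) := by
    rw [sineIntegral, intervalIntegral.integral_of_le hR.le]
    refine setIntegral_congr_fun measurableSet_Ioc (fun t ht => ?_)
    rw [integral_const_mul, integral_exp_neg_mul_Ioi_zero ht.1, Real.sinc_of_ne_zero ht.1.ne']
    ring
  rw [h1, integral_integral_swap]
  · refine setIntegral_congr_fun measurableSet_Ioi (fun s _ => ?_)
    rw [← intervalIntegral.integral_of_le hR.le, integral_sin_mul_exp_neg]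
  · rw [integrable_prod_iff (Continuous.aestronglyMeasurable (by fun_prop))]
    refine ⟨(ae_restrict_iff' measurableSet_Ioc).2 (ae_of_all _ fun t ht =>
      (integrableOn_exp_neg_mul_Ioi ht.1).const_mul (Real.sin t)), ?_⟩
    have : IntegrableOn (fun t => |Real.sinc t|) (Set.Ioc 0 R) :=
      (Real.continuous_sinc.abs.integrableOn_Icc).mono_set Set.Ioc_subset_Icc_self
    refine this.congr_fun (fun t ht => ?_) measurableSet_Ioc
    simp only [Function.uncurry_apply_pair, norm_mul, Real.norm_eq_abs, Real.abs_exp]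
    rw [integral_const_mul, integral_exp_neg_mul_Ioi_zero ht.1, Real.sinc_of_ne_zero ht.1.ne',
      abs_div, abs_of_pos ht.1]
    ring

/-- The Dirichlet integral `∫₀^∞ sin t / t dt = π / 2`. -/
theorem tendsto_sineIntegral_atTop : Tendsto sineIntegral atTop (𝓝 (Real.pi / 2)) := by
  have hlim : Tendsto (fun R : ℝ => ∫ s in Set.Ioi (0 : ℝ), ((1 + s ^ 2)⁻¹ -
      Real.exp (-(s * R)) * (Real.cos R + s * Real.sin R) * (1 + s ^ 2)⁻¹)) atTop
      (𝓝 (∫ s in Set.Ioi (0 : ℝ), (1 + s ^ 2)⁻¹)) := by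
    have hb : ∀ᶠ R : ℝ in atTop, ∀ s : ℝ, 0 < s →
        ‖Real.exp (-(s * R)) * (Real.cos R + s * Real.sin R)‖ ≤ Real.exp (-(s * R)) * (1 + s) := by
      filter_upwards with R s hs
      rw [norm_mul, Real.norm_eq_abs, Real.abs_exp]
      gcongr
      refine (norm_add_le _ _).trans (add_le_add (Real.abs_cos_le_one R) ?_)
      rw [norm_mul, Real.norm_eq_abs, Real.norm_eq_abs, abs_of_pos hs]
      exact mul_le_of_le_one_right hs.le (Real.abs_sin_le_one R)
    -- For `R ≥ 1` the oscillating factor is at most `e^{-s}(1 + s) ≤ 1`; together with the leading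
    -- `1` this gives the constant `2`.
    refine tendsto_integral_filter_of_dominated_convergence (fun s => 2 * (1 + s ^ 2)⁻¹)
      (Eventually.of_forall fun R => ?_) ?_ ?_ ?_
    · refine Continuous.aestronglyMeasurable ?_
      have : ∀ s : ℝ, 1 + s ^ 2 ≠ 0 := fun s => by positivity
      fun_prop (disch := assumption)
    · filter_upwards [hb, eventually_ge_atTop 1] with R hR hR1
      refine (ae_restrict_iff' measurableSet_Ioi).2 (ae_of_all _ fun s hs => ?_)
      have hs : 0 < s := hs
      have h1 : Real.exp (-(s * R)) * (1 + s) ≤ 1 := by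
        have h2 : Real.exp (-(s * R)) ≤ Real.exp (-s) := Real.exp_le_exp.2 (by nlinarith)
        calc _ ≤ Real.exp (-s) * Real.exp s := by
              gcongr; linarith [Real.add_one_le_exp s]
          _ = 1 := by rw [← Real.exp_add]; simp
      have h3 := (hR s hs).trans h1
      have hp : 0 < (1 + s ^ 2)⁻¹ := by positivity
      calc _ = ‖(1 - Real.exp (-(s * R)) * (Real.cos R + s * Real.sin R)) * (1 + s ^ 2)⁻¹‖ := by
            congr 1; ring
        _ ≤ 2 * (1 + s ^ 2)⁻¹ := by
            rw [norm_mul, Real.norm_of_nonneg hp.le]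
            gcongr
            refine (norm_sub_le _ _).trans ?_
            simp only [norm_one]; linarith
    · exact (integrable_inv_one_add_sq.const_mul 2).integrableOn
    · refine (ae_restrict_iff' measurableSet_Ioi).2 (ae_of_all _ fun s hs => ?_)
      have hs : 0 < s := hs
      have h0 : Tendsto (fun R : ℝ => Real.exp (-(s * R)) * (1 + s)) atTop (𝓝 0) := by
        have : Tendsto (fun R : ℝ => Real.exp (-(s * R))) atTop (𝓝 0) :=
          Real.tendsto_exp_neg_atTop_nhds_zero.comp (tendsto_id.const_mul_atTop hs)
        simpa using this.mul_const (1 + s)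
      have h1 : Tendsto (fun R : ℝ => Real.exp (-(s * R)) * (Real.cos R + s * Real.sin R))
          atTop (𝓝 0) :=
        squeeze_zero_norm' (hb.mono fun R hR => hR s hs) h0
      simpa using (tendsto_const_nhds (x := (1 + s ^ 2)⁻¹)).sub (h1.mul_const (1 + s ^ 2)⁻¹)
  rw [integral_Ioi_inv_one_add_sq] at hlim
  simp only [Real.arctan_zero, sub_zero] at hlim
  refine hlim.congr' ?_
  filter_upwards [eventually_gt_atTop 0] with R hR
  rw [sineIntegral_eq hR]

theorem sineIntegral_neg (x : ℝ) : sineIntegral (-x) = -sineIntegral x := by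
  have := intervalIntegral.integral_comp_neg (a := 0) (b := x) Real.sinc
  simp only [Real.sinc_neg, neg_zero] at this
  rw [sineIntegral, sineIntegral, this, intervalIntegral.integral_symm]

theorem tendsto_sineIntegral_atBot : Tendsto sineIntegral atBot (𝓝 (-(Real.pi / 2))) := by
  have := (tendsto_sineIntegral_atTop.comp tendsto_neg_atBot_atTop).neg
  refine this.congr fun x => ?_
  simp [sineIntegral_neg]

theorem continuous_sineIntegral : Continuous sineIntegral :=
  intervalIntegral.continuous_primitive
    (fun _ _ => Real.continuous_sinc.intervalIntegrable _ _) 0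

theorem exists_abs_sineIntegral_le : ∃ C : ℝ, 0 ≤ C ∧ ∀ x, |sineIntegral x| ≤ C := by
  have h1 := tendsto_sineIntegral_atTop.abs.eventually_le_const
    (show |Real.pi / 2| < |Real.pi / 2| + 1 by linarith)
  obtain ⟨R, hR⟩ := eventually_atTop.1 h1
  obtain ⟨C, hC⟩ := (isCompact_Icc (a := 0) (b := R)).exists_bound_of_continuousOn
    continuous_sineIntegral.continuousOn
  have hpos : ∀ x, 0 ≤ x → |sineIntegral x| ≤ max C (|Real.pi / 2| + 1) := by
    intro x hx
    rcases le_total x R with h | h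
    · exact le_max_of_le_left (hC x ⟨hx, h⟩)
    · exact le_max_of_le_right (hR x h)
  refine ⟨max C (|Real.pi / 2| + 1), (abs_nonneg _).trans (hpos 0 le_rfl), fun x => ?_⟩
  rcases le_total 0 x with h | h
  · exact hpos x h
  · have := hpos (-x) (by linarith)
    rwa [sineIntegral_neg, abs_neg] at this

/-! ### Truncated Fourier integrals of the cardinal sine -/

theorem cis_add (x y : ℝ) : cis (x + y) = cis x * cis y := by
  rw [cis, cis, cis, ← Complex.exp_add]; push_cast; ring_nf

@[simp] theorem cis_zero : cis 0 = 1 := by simp [cis]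

@[simp] theorem norm_cis (x : ℝ) : ‖cis x‖ = 1 := by
  rw [cis, show (2 * Real.pi * x * Complex.I : ℂ) = ((2 * Real.pi * x : ℝ) : ℂ) * Complex.I by
    push_cast; ring]
  exact Complex.norm_exp_ofReal_mul_I _

theorem continuous_cis : Continuous cis := by unfold cis; fun_prop

@[fun_prop] theorem Continuous.cis {X : Type*} [TopologicalSpace X] {f : X → ℝ}
    (hf : Continuous f) : Continuous fun x => cis (f x) := continuous_cis.comp hf

@[simp] theorem cis_intCast (n : ℤ) : cis n = 1 := by
  rw [cis, show (2 * Real.pi * ((n : ℝ) : ℂ) * Complex.I : ℂ) = n * (2 * Real.pi * Complex.I) by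
    push_cast; ring]
  exact Complex.exp_int_mul_two_pi_mul_I n

theorem conj_cis (x : ℝ) : (starRingEnd ℂ) (cis x) = cis (-x) := by
  rw [cis, cis, ← Complex.exp_conj]; congr 1; simp [Complex.conj_ofNat]

theorem cis_add_cis_neg (x : ℝ) : cis x + cis (-x) = (2 * Real.cos (2 * Real.pi * x) : ℝ) := by
  rw [cis, cis]; push_cast
  rw [Complex.two_cos]
  congr 2; ring

@[fun_prop] theorem continuous_nsinc : Continuous nsinc :=
  Real.continuous_sinc.comp (by fun_prop)

/-- The Fourier integral over `[-b, b]` of `√β sinc(β u)`. -/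
noncomputable def sincFourier (β b x : ℝ) : ℂ :=
  ∫ u in (-b)..b, ((Real.sqrt β * nsinc (β * u) : ℝ) : ℂ) * cis (x * u)

/-- This is `sin(a + b) + sin(a - b) = 2 sin a cos b` divided by `2u`, in a form that survives `u =
0` and `p = ±q`. -/
theorem mul_sinc_add_mul_sinc (p q u : ℝ) :
    (p + q) * Real.sinc (2 * u * (p + q)) + (p - q) * Real.sinc (2 * u * (p - q)) =
      2 * p * Real.sinc (2 * p * u) * Real.cos (2 * q * u) := by
  have key : ∀ a c : ℝ, a * Real.sinc (c * a) * c = Real.sin (c * a) := by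
    intro a c
    by_cases h : c * a = 0
    · rcases mul_eq_zero.1 h with h | h <;> simp [h]
    · rw [Real.sinc_of_ne_zero h]; rw [mul_right_comm, mul_comm a c, mul_div_cancel₀ _ h]
  by_cases hu : u = 0
  · simp [hu]; ring
  have h2 : (2 * u) ≠ 0 := by positivity
  apply mul_right_cancel₀ h2
  have e : 2 * p * Real.sinc (2 * p * u) * Real.cos (2 * q * u) * (2 * u) =
      2 * (p * Real.sinc (2 * u * p) * (2 * u)) * Real.cos (2 * q * u) := by
    rw [show 2 * p * u = 2 * u * p by ring]; ring
  rw [add_mul, key, key, e, key, mul_add, mul_sub, Real.sin_add, Real.sin_sub,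
    show 2 * q * u = 2 * u * q by ring]
  ring

theorem integral_mul_sinc (c b : ℝ) :
    ∫ u in (0 : ℝ)..b, c * Real.sinc (c * u) = sineIntegral (c * b) := by
  rw [intervalIntegral.integral_const_mul]
  simp [sineIntegral]

/-- Folding `[-b, b]` onto `[0, b]` turns the exponential into a cosine, and product-to-sum leaves
two sincs scaled by the distances from `x` to the edges `±β/2`. -/
theorem sincFourier_eq {β : ℝ} (hβ : 0 < β) (b x : ℝ) :
    sincFourier β b x = ((1 / (Real.pi * Real.sqrt β) *
      (sineIntegral (2 * Real.pi * (β / 2 + x) * b) +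
        sineIntegral (2 * Real.pi * (β / 2 - x) * b)) : ℝ) : ℂ) := by
  have hs : Real.sqrt β * Real.sqrt β = β := Real.mul_self_sqrt hβ.le
  have hs0 : Real.sqrt β ≠ 0 := (Real.sqrt_pos.2 hβ).ne'
  set f : ℝ → ℂ := fun u => ((Real.sqrt β * nsinc (β * u) : ℝ) : ℂ) * cis (x * u) with hf
  have hfc : Continuous f := by fun_prop
  have hfn : Continuous fun u => f (-u) := hfc.comp continuous_neg
  have h1 : sincFourier β b x = ∫ u in (0 : ℝ)..b, (f u + f (-u)) := by
    rw [intervalIntegral.integral_add (hfc.intervalIntegrable _ _)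
      (hfn.intervalIntegrable _ _), intervalIntegral.integral_comp_neg,
      sincFourier, neg_zero, add_comm]
    exact (intervalIntegral.integral_add_adjacent_intervals (hfc.intervalIntegrable _ _)
      (hfc.intervalIntegrable _ _)).symm
  rw [h1, ← integral_mul_sinc, ← integral_mul_sinc, ← intervalIntegral.integral_add
    (Continuous.intervalIntegrable (by have := Real.continuous_sinc; fun_prop) _ _)
    (Continuous.intervalIntegrable (by have := Real.continuous_sinc; fun_prop) _ _),
    ← intervalIntegral.integral_const_mul, ← intervalIntegral.integral_ofReal]
  refine intervalIntegral.integral_congr fun u _ => ?_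
  have hn : nsinc (β * -u) = nsinc (β * u) := by
    rw [nsinc, nsinc, ← Real.sinc_neg]; congr 1; ring
  simp only [hf]
  rw [hn, ← mul_add, mul_neg, cis_add_cis_neg, ← Complex.ofReal_mul]
  congr 1
  have := mul_sinc_add_mul_sinc (β / 2) x (Real.pi * u)
  have e1 : 2 * Real.pi * (β / 2 + x) * Real.sinc (2 * Real.pi * (β / 2 + x) * u) +
      2 * Real.pi * (β / 2 - x) * Real.sinc (2 * Real.pi * (β / 2 - x) * u) =
      2 * Real.pi * (β * Real.sinc (Real.pi * (β * u)) * Real.cos (2 * Real.pi * (x * u))) := by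
    rw [show 2 * Real.pi * (β / 2 + x) * u = 2 * (Real.pi * u) * (β / 2 + x) by ring,
      show 2 * Real.pi * (β / 2 - x) * u = 2 * (Real.pi * u) * (β / 2 - x) by ring,
      show Real.pi * (β * u) = 2 * (β / 2) * (Real.pi * u) by ring,
      show 2 * Real.pi * (x * u) = 2 * x * (Real.pi * u) by ring,
      show β * Real.sinc (2 * (β / 2) * (Real.pi * u)) =
        2 * (β / 2) * Real.sinc (2 * (β / 2) * (Real.pi * u)) by ring, ← this]
    ring
  rw [e1, nsinc]
  have hp := Real.pi_ne_zero
  field_simp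
  rw [pow_two, hs]

/-- The bound is uniform in the truncation and in the frequency. It supplies the dominating function
for the window and the operator bound for the filter. -/
theorem exists_norm_sincFourier_le {β : ℝ} (hβ : 0 < β) :
    ∃ C : ℝ, 0 ≤ C ∧ ∀ b x, ‖sincFourier β b x‖ ≤ C := by
  obtain ⟨C, hC0, hC⟩ := exists_abs_sineIntegral_le
  have hp : 0 ≤ 1 / (Real.pi * Real.sqrt β) := by positivity
  refine ⟨1 / (Real.pi * Real.sqrt β) * (C + C), by positivity, fun b x => ?_⟩
  rw [sincFourier_eq hβ, Complex.norm_real, norm_mul, Real.norm_of_nonneg hp]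
  gcongr
  exact (norm_add_le _ _).trans (add_le_add (hC _) (hC _))

theorem tendsto_sineIntegral_mul_of_pos {c : ℝ} (hc : 0 < c) :
    Tendsto (fun b => sineIntegral (c * b)) atTop (𝓝 (Real.pi / 2)) :=
  tendsto_sineIntegral_atTop.comp (tendsto_id.const_mul_atTop hc)

theorem tendsto_sineIntegral_mul_of_neg {c : ℝ} (hc : c < 0) :
    Tendsto (fun b => sineIntegral (c * b)) atTop (𝓝 (-(Real.pi / 2))) :=
  tendsto_sineIntegral_atBot.comp (tendsto_id.const_mul_atTop_of_neg hc)

/-- The two sine integrals tend to `π/2` with equal signs inside the band and opposite signs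
outside. At the edges one of them vanishes and the limit is half the height, so these points are
excluded. -/
theorem tendsto_sincFourier {β x : ℝ} (hβ : 0 < β) (h1 : x ≠ β / 2) (h2 : x ≠ -(β / 2)) :
    Tendsto (fun b => sincFourier β b x) atTop
      (𝓝 ((Set.Ico (-(β / 2)) (β / 2)).indicator (fun _ => ((1 / Real.sqrt β : ℝ) : ℂ)) x)) := by
  have key : ∀ l m : ℝ, Tendsto (fun b => sineIntegral (2 * Real.pi * (β / 2 + x) * b)) atTop (𝓝 l) →
      Tendsto (fun b => sineIntegral (2 * Real.pi * (β / 2 - x) * b)) atTop (𝓝 m) →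
      Tendsto (fun b => sincFourier β b x) atTop
        (𝓝 ((1 / (Real.pi * Real.sqrt β) * (l + m) : ℝ) : ℂ)) := by
    intro l m hl hm
    simp only [sincFourier_eq hβ]
    exact (Complex.continuous_ofReal.tendsto _).comp ((hl.add hm).const_mul _)
  have hp := Real.pi_pos
  rcases lt_or_gt_of_ne h1 with h | h
  · rcases lt_or_gt_of_ne h2 with h' | h'
    · rw [Set.indicator_of_notMem (by simp [h'])]
      have := key _ _
        (tendsto_sineIntegral_mul_of_neg (mul_neg_of_pos_of_neg (by positivity) (by linarith)))
        (tendsto_sineIntegral_mul_of_pos (mul_pos (by positivity) (by linarith)))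
      simpa using this
    · rw [Set.indicator_of_mem (Set.mem_Ico.2 ⟨h'.le, h⟩)]
      have := key _ _
        (tendsto_sineIntegral_mul_of_pos (mul_pos (by positivity) (by linarith)))
        (tendsto_sineIntegral_mul_of_pos (mul_pos (by positivity) (by linarith)))
      convert this using 3
      have hs0 : Real.sqrt β ≠ 0 := (Real.sqrt_pos.2 hβ).ne'
      field_simp
      norm_num
  · rw [Set.indicator_of_notMem (by simp [h.le])]
    have := key _ _
      (tendsto_sineIntegral_mul_of_pos (mul_pos (by positivity) (by linarith)))
      (tendsto_sineIntegral_mul_of_neg (mul_neg_of_pos_of_neg (by positivity) (by linarith)))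
    simpa using this

/-! ### Plancherel's theorem for integrable square integrable functions -/

section Plancherel
open FourierTransform SchwartzMap

/-- Both transforms have the same pairing with every test function: for the integral the transform
moves across by Fubini, for the `L²` extension by duality of tempered distributions. -/
theorem fourierInv_toLp_ae_eq {u : ℝ → ℂ} (hu : Integrable u) (hu2 : MemLp u 2) :
    𝓕⁻ u =ᵐ[volume] (𝓕⁻ (hu2.toLp u) : Lp ℂ 2 (volume : Measure ℝ)) := by
  have hcont : Continuous (𝓕⁻ u) :=
    VectorFourier.fourierIntegral_continuous Real.continuous_fourierChar
      (by simp only [LinearMap.neg_apply]; exact continuous_inner.neg) hu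
  refine ae_eq_of_integral_contDiff_smul_eq hcont.locallyIntegrable
    ((Lp.memLp _).locallyIntegrable one_le_two) fun g g_smooth g_cpt => ?_
  have hg₁ : HasCompactSupport (Complex.ofRealCLM ∘ g) := g_cpt.comp_left rfl
  have hg₂ : ContDiff ℝ (⊤ : ℕ∞) (Complex.ofRealCLM ∘ g) := by fun_prop
  set G : 𝓢(ℝ, ℂ) := hg₁.toSchwartzMap hg₂ with hG
  have h1 : ∫ x, G x * 𝓕⁻ u x = ∫ x, 𝓕⁻ G x * u x := by
    have := VectorFourier.integral_bilin_fourierIntegral_eq_flip (μ := volume) (ν := volume)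
      (L := -innerₗ ℝ) (ContinuousLinearMap.mul ℂ ℂ)
      Real.continuous_fourierChar
      (by simp only [LinearMap.neg_apply]; exact continuous_inner.neg) G.integrable hu
    have hflip : (-innerₗ ℝ : ℝ →ₗ[ℝ] ℝ →ₗ[ℝ] ℝ).flip = -innerₗ ℝ := by
      ext; simp
    rw [hflip] at this
    rw [fourierInv_coe]
    exact this.symm
  have h2 := DFunLike.congr_fun (Lp.fourierInv_toTemperedDistribution_eq (hu2.toLp u)) G
  rw [TemperedDistribution.fourierInv_apply, Lp.toTemperedDistribution_apply,
    Lp.toTemperedDistribution_apply] at h2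
  calc ∫ x, g x • 𝓕⁻ u x = ∫ x, G x * 𝓕⁻ u x := by simp [hG]
    _ = ∫ x, 𝓕⁻ G x • (hu2.toLp u) x := by
      rw [h1]
      refine integral_congr_ae ?_
      filter_upwards [hu2.coeFn_toLp] with x hx
      rw [hx, smul_eq_mul]
    _ = _ := h2
    _ = _ := by simp [hG]

theorem eLpNorm_fourierInv_eq {u : ℝ → ℂ} (hu : Integrable u) (hu2 : MemLp u 2) :
    eLpNorm (𝓕⁻ u) 2 volume = eLpNorm u 2 volume := by
  rw [eLpNorm_congr_ae (fourierInv_toLp_ae_eq hu hu2), ← Lp.enorm_def, ← enorm_norm]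
  have : ‖(𝓕⁻ (hu2.toLp u) : Lp ℂ 2 (volume : Measure ℝ))‖ = ‖hu2.toLp u‖ :=
    (Lp.fourierTransformₗᵢ ℝ ℂ).symm.norm_map _
  rw [this, enorm_norm, Lp.enorm_toLp]

end Plancherel

/-! ### Convolution of square integrable functions -/

theorem memLp_two_comp_sub {g : ℝ → ℂ} (hg : MemLp g 2) (t : ℝ) :
    MemLp (fun s => g (t - s)) 2 :=
  hg.comp_measurePreserving (Measure.measurePreserving_sub_left volume t)

theorem eLpNorm_two_comp_sub {g : ℝ → ℂ} (hg : MemLp g 2) (t : ℝ) :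
    eLpNorm (fun s => g (t - s)) 2 volume = eLpNorm g 2 volume :=
  eLpNorm_comp_measurePreserving hg.1 (Measure.measurePreserving_sub_left volume t)

theorem integrable_mul_comp_sub {f g : ℝ → ℂ} (hf : MemLp f 2) (hg : MemLp g 2) (t : ℝ) :
    Integrable fun s => f s * g (t - s) :=
  MemLp.integrable_mul hf (memLp_two_comp_sub hg t)

/-- The convolution of two complex signals. -/
noncomputable abbrev conv (f g : ℝ → ℂ) : ℝ → ℂ :=
  convolution f g (ContinuousLinearMap.mul ℝ ℂ) volume

theorem conv_apply (f g : ℝ → ℂ) (t : ℝ) : conv f g t = ∫ s, f s * g (t - s) := rfl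

/-- Cauchy–Schwarz. As the bound does not depend on `t`, `L²` convergence of either factor gives
uniform convergence of the convolution. -/
theorem enorm_conv_le {f g : ℝ → ℂ} (hf : MemLp f 2) (hg : MemLp g 2) (t : ℝ) :
    ‖conv f g t‖ₑ ≤ eLpNorm f 2 volume * eLpNorm g 2 volume := by
  rw [conv_apply]
  refine (enorm_integral_le_lintegral_enorm _).trans ?_
  rw [← eLpNorm_one_eq_lintegral_enorm, ← eLpNorm_two_comp_sub hg t]
  have := eLpNorm_le_eLpNorm_mul_eLpNorm_of_nnnorm (p := 2) (q := 2) (r := 1) hf.1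
    (memLp_two_comp_sub hg t).1 (fun x y : ℂ => x * y) 1 (ae_of_all _ fun s => by simp)
  rwa [ENNReal.coe_one, one_mul] at this

theorem conv_sub_left {f f' g : ℝ → ℂ} (hf : MemLp f 2) (hf' : MemLp f' 2) (hg : MemLp g 2) :
    conv (f - f') g = conv f g - conv f' g := by
  ext t
  simp only [conv_apply, Pi.sub_apply, sub_mul]
  exact integral_sub (integrable_mul_comp_sub hf hg t) (integrable_mul_comp_sub hf' hg t)

theorem conv_sub_right {f g g' : ℝ → ℂ} (hf : MemLp f 2) (hg : MemLp g 2) (hg' : MemLp g' 2) :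
    conv f (g - g') = conv f g - conv f g' := by
  ext t
  simp only [conv_apply, Pi.sub_apply, mul_sub]
  exact integral_sub (integrable_mul_comp_sub hf hg t) (integrable_mul_comp_sub hf hg' t)

theorem tendsto_conv_left {ι : Type*} {l : Filter ι} {f : ι → ℝ → ℂ} {f₀ g : ℝ → ℂ}
    (hf : ∀ i, MemLp (f i) 2) (hf₀ : MemLp f₀ 2) (hg : MemLp g 2)
    (h : Tendsto (fun i => eLpNorm (f i - f₀) 2 volume) l (𝓝 0)) :
    TendstoUniformly (fun i => conv (f i) g) (conv f₀ g) l := by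
  rw [EMetric.tendstoUniformly_iff]
  intro ε hε
  have h' : Tendsto (fun i => eLpNorm (f i - f₀) 2 volume * eLpNorm g 2 volume) l (𝓝 0) := by
    simpa using ENNReal.Tendsto.mul_const h (Or.inr hg.2.ne)
  filter_upwards [h'.eventually_lt_const hε] with i hi t
  rw [edist_comm, edist_eq_enorm_sub, ← Pi.sub_apply, ← conv_sub_left (hf i) hf₀ hg]
  exact (enorm_conv_le ((hf i).sub hf₀) hg t).trans_lt hi

theorem tendsto_conv_right {ι : Type*} {l : Filter ι} {f g₀ : ℝ → ℂ} {g : ι → ℝ → ℂ}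
    (hf : MemLp f 2) (hg : ∀ i, MemLp (g i) 2) (hg₀ : MemLp g₀ 2)
    (h : Tendsto (fun i => eLpNorm (g i - g₀) 2 volume) l (𝓝 0)) :
    TendstoUniformly (fun i => conv f (g i)) (conv f g₀) l := by
  rw [EMetric.tendstoUniformly_iff]
  intro ε hε
  have h' : Tendsto (fun i => eLpNorm f 2 volume * eLpNorm (g i - g₀) 2 volume) l (𝓝 0) := by
    simpa using ENNReal.Tendsto.const_mul h (Or.inr hf.2.ne)
  filter_upwards [h'.eventually_lt_const hε] with i hi t
  rw [edist_comm, edist_eq_enorm_sub, ← Pi.sub_apply, ← conv_sub_right hf (hg i) hg₀]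
  exact (enorm_conv_le hf ((hg i).sub hg₀) t).trans_lt hi

theorem exists_seq_schwartzMap_tendsto {g : ℝ → ℂ} (hg : MemLp g 2) :
    ∃ φ : ℕ → SchwartzMap ℝ ℂ, Tendsto (fun n => eLpNorm (⇑(φ n) - g) 2 volume) atTop (𝓝 0) := by
  have hd := SchwartzMap.denseRange_toLpCLM (E := ℝ) (F := ℂ) (p := 2) (μ := volume)
    ENNReal.ofNat_ne_top
  obtain ⟨x, hx, hlim⟩ := mem_closure_iff_seq_limit.1 (hd (hg.toLp g))
  choose φ hφ using hx
  refine ⟨φ, ?_⟩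
  rw [Lp.tendsto_Lp_iff_tendsto_eLpNorm'] at hlim
  refine hlim.congr fun n => eLpNorm_congr_ae ?_
  have h1 : (x n : ℝ → ℂ) =ᵐ[volume] φ n := by
    rw [← hφ n]; exact (φ n).coeFn_toLp 2 volume
  exact h1.sub hg.coeFn_toLp

/-- A uniform limit of convolutions with compactly supported continuous functions. In particular the
point samples of `w₃ ⋆ r` are meaningful. -/
theorem continuous_conv {f g : ℝ → ℂ} (hf : MemLp f 2) (hg : MemLp g 2) :
    Continuous (conv f g) := by
  have key : ∀ n : ℕ, ∃ u, HasCompactSupport u ∧ eLpNorm (g - u) 2 volume ≤ (n + 1 : ENNReal)⁻¹ ∧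
      Continuous u ∧ MemLp u 2 volume := fun n =>
    hg.exists_hasCompactSupport_eLpNorm_sub_le ENNReal.ofNat_ne_top
      (ENNReal.inv_ne_zero.2 (by finiteness))
  choose u hu1 hu2 hu3 hu4 using key
  have hlim : Tendsto (fun n => eLpNorm (u n - g) 2 volume) atTop (𝓝 0) := by
    refine tendsto_of_tendsto_of_tendsto_of_le_of_le tendsto_const_nhds
      (h := fun n : ℕ => (n + 1 : ENNReal)⁻¹) ?_ (fun _ => zero_le) fun n => ?_
    · have := (tendsto_add_atTop_iff_nat 1).2 ENNReal.tendsto_inv_nat_nhds_zero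
      exact_mod_cast this
    · rw [eLpNorm_sub_comm]; exact hu2 n
  refine (tendsto_conv_right hf hu4 hg hlim).continuous (Frequently.of_forall fun n => ?_)
  exact (hu1 n).continuous_convolution_right _ (hf.locallyIntegrable one_le_two) (hu3 n)

section
open FourierTransform SchwartzMap

/-- Convolution with an integrable function acts on Schwartz functions as a Fourier multiplier. -/
theorem eLpNorm_conv_schwartzMap {f : ℝ → ℂ} (hf : Integrable f) (φ : 𝓢(ℝ, ℂ)) :
    eLpNorm (conv f φ) 2 volume = eLpNorm (fun ξ => 𝓕 f ξ * 𝓕 (φ : ℝ → ℂ) ξ) 2 volume := by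
  have hFc : Continuous (𝓕 f) := VectorFourier.fourierIntegral_continuous
    Real.continuous_fourierChar continuous_inner hf
  have hFb : ∀ ξ, ‖𝓕 f ξ‖ ≤ ∫ v, ‖f v‖ := fun ξ => 
    VectorFourier.norm_fourierIntegral_le_integral_norm _ _ _ f ξ
  have hint : Integrable (fun ξ => 𝓕 f ξ * 𝓕 (φ : ℝ → ℂ) ξ) :=
    (𝓕 φ).integrable.bdd_mul hFc.aestronglyMeasurable (ae_of_all _ hFb)
  have hL2 : MemLp (fun ξ => 𝓕 f ξ * 𝓕 (φ : ℝ → ℂ) ξ) 2 :=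
    ((𝓕 φ).memLp 2 volume).of_le_mul hint.1 (ae_of_all _ fun ξ => by
      rw [norm_mul]; exact mul_le_mul_of_nonneg_right (hFb ξ) (norm_nonneg _))
  have hF : 𝓕 (conv f φ) = fun ξ => 𝓕 f ξ * 𝓕 (φ : ℝ → ℂ) ξ := by
    ext ξ
    exact Real.fourier_mul_convolution_eq hf φ.integrable ξ
  have hcont : Continuous (conv f φ) := by
    refine BddAbove.continuous_convolution_right_of_integrable _ ?_ hf φ.continuous
    obtain ⟨C, hC⟩ := φ.toBoundedContinuousFunction.isBounded_range.exists_norm_le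
    exact ⟨C, by rintro _ ⟨x, rfl⟩; exact hC _ ⟨x, rfl⟩⟩
  have hci : Integrable (conv f φ) := hf.integrable_convolution _ φ.integrable
  rw [← eLpNorm_fourierInv_eq hint hL2, ← hF,
    hcont.fourierInv_fourier_eq hci (by rw [hF]; exact hint)]

theorem eLpNorm_fourier_schwartzMap (φ : 𝓢(ℝ, ℂ)) :
    eLpNorm (𝓕 (φ : ℝ → ℂ)) 2 volume = eLpNorm φ 2 volume := by
  rw [← fourier_coe, ← eLpNorm_fourierInv_eq (𝓕 φ).integrable ((𝓕 φ).memLp 2 volume),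
    ← fourierInv_coe, FourierTransform.fourierInv_fourier_eq]

end

/-! ### Removing the truncation of a convolution kernel -/

theorem eLpNorm_two_sq {α E : Type*} {_ : MeasurableSpace α} [NormedAddCommGroup E]
    (f : α → E) (μ : Measure α) : eLpNorm f 2 μ ^ 2 = ∫⁻ x, ‖f x‖ₑ ^ 2 ∂μ := by
  have := eLpNorm_nnreal_pow_eq_lintegral (f := f) (μ := μ) (p := 2) two_ne_zero
  simpa using this

theorem ENNReal.tendsto_zero_of_sq {ι : Type*} {l : Filter ι} {u : ι → ENNReal}
    (h : Tendsto (fun i => u i ^ 2) l (𝓝 0)) : Tendsto u l (𝓝 0) := by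
  have h2 := h.ennrpow_const (1 / 2 : ℝ)
  rw [ENNReal.zero_rpow_of_pos (by norm_num)] at h2
  refine h2.congr fun i => ?_
  rw [← ENNReal.rpow_natCast, ← ENNReal.rpow_mul]
  norm_num

theorem tendsto_eLpNorm_two_zero_of_dominated {α ι : Type*} {_ : MeasurableSpace α}
    {μ : Measure α} {l : Filter ι} [l.IsCountablyGenerated] {F : ι → α → ℂ} {g : α → ℝ}
    (hF : ∀ i, AEStronglyMeasurable (F i) μ) (hb : ∀ i, ∀ᵐ x ∂μ, ‖F i x‖ ≤ g x)
    (hg : MemLp g 2 μ) (hlim : ∀ᵐ x ∂μ, Tendsto (fun i => F i x) l (𝓝 0)) :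
    Tendsto (fun i => eLpNorm (F i) 2 μ) l (𝓝 0) := by
  have hb2 : ∀ i, ∀ᵐ x ∂μ, ‖‖F i x‖ ^ 2‖ ≤ g x ^ 2 := fun i => by
    filter_upwards [hb i] with x hx
    rw [norm_pow, norm_norm]; gcongr
  have hg2 : Integrable (fun x => g x ^ 2) μ := hg.integrable_sq
  have h1 : Tendsto (fun i => ∫ x, ‖F i x‖ ^ 2 ∂μ) l (𝓝 (∫ _, (0 : ℝ) ∂μ)) :=
    tendsto_integral_filter_of_dominated_convergence (fun x => g x ^ 2)
      (Eventually.of_forall fun i => (hF i).norm.pow 2) (Eventually.of_forall hb2) hg2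
      (hlim.mono fun x hx => by simpa using hx.norm.pow 2)
  rw [integral_zero] at h1
  refine ENNReal.tendsto_zero_of_sq ?_
  have h2 := (ENNReal.continuous_ofReal.tendsto _).comp h1
  rw [ENNReal.ofReal_zero] at h2
  refine h2.congr fun i => ?_
  have hi : Integrable (fun x => ‖F i x‖ ^ 2) μ := hg2.mono' ((hF i).norm.pow 2) (hb2 i)
  rw [Function.comp, ofReal_integral_eq_lintegral_ofReal hi (ae_of_all _ fun x => by positivity),
    eLpNorm_two_sq]
  refine lintegral_congr fun x => ?_
  rw [ENNReal.ofReal_pow (norm_nonneg _), ofReal_norm]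

/-- Fatou's lemma: bounds proved for approximations pass to pointwise limits without knowing that
these are `L²` limits. -/
theorem eLpNorm_le_of_tendsto {α : Type*} {_ : MeasurableSpace α} {μ : Measure α}
    {f : ℕ → α → ℂ} {f₀ : α → ℂ} {u : ℕ → ENNReal} {c : ENNReal}
    (hf : ∀ n, AEStronglyMeasurable (f n) μ)
    (hlim : ∀ᵐ x ∂μ, Tendsto (fun n => f n x) atTop (𝓝 (f₀ x)))
    (hu : ∀ᶠ n in atTop, eLpNorm (f n) 2 μ ≤ u n) (hc : Tendsto u atTop (𝓝 c)) :
    eLpNorm f₀ 2 μ ≤ c :=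
  (Lp.eLpNorm_lim_le_liminf_eLpNorm hf f₀ hlim).trans
    ((liminf_le_liminf hu).trans_eq hc.liminf_eq)

theorem tendsto_eLpNorm_indicator_compl_Icc {w : ℝ → ℂ} (hw : MemLp w 2) :
    Tendsto (fun a : ℝ => eLpNorm ((Set.Icc (-a) a)ᶜ.indicator w) 2 volume) atTop (𝓝 0) := by
  refine tendsto_eLpNorm_two_zero_of_dominated (g := fun x => ‖w x‖)
    (fun a => (hw.indicator measurableSet_Icc.compl).1)
    (fun a => ae_of_all _ fun x => norm_indicator_le_norm_self _ _) hw.norm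
    (ae_of_all _ fun x => ?_)
  refine tendsto_const_nhds.congr' ?_
  filter_upwards [eventually_ge_atTop |x|] with a ha
  rw [Set.indicator_of_notMem]
  simpa using abs_le.1 ha

section
open FourierTransform SchwartzMap

variable {w : ℝ → ℂ}

theorem fourier_indicator_Icc {a : ℝ} (ha : 0 ≤ a) (ξ : ℝ) :
    𝓕 ((Set.Icc (-a) a).indicator w) ξ = ∫ u in (-a)..a, w u * cis (-ξ * u) := by
  rw [Real.fourier_real_eq, intervalIntegral.integral_of_le (by linarith),
    ← integral_Icc_eq_integral_Ioc, ← integral_indicator measurableSet_Icc]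
  congr 1; ext v
  by_cases hv : v ∈ Set.Icc (-a) a
  · rw [Set.indicator_of_mem hv, Set.indicator_of_mem hv, Circle.smul_def, Real.fourierChar_apply,
      cis, smul_eq_mul, mul_comm]
    congr 2; push_cast; ring
  · simp [Set.indicator_of_notMem hv]

theorem integrable_indicator_Icc (hw : MemLp w 2) (a : ℝ) :
    Integrable ((Set.Icc (-a) a).indicator w) :=
  (integrable_indicator_iff measurableSet_Icc).2
    ((hw.locallyIntegrable one_le_two).integrableOn_isCompact isCompact_Icc)

/-- The tail of `w` need not be integrable, so the multiplier identity is applied to its cut-offs,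
the differences of the truncations to `[-n, n]` and `[-a, a]`. Their convolutions with `φ` converge
pointwise, and Fatou finishes. -/
theorem eLpNorm_conv_tail_schwartzMap_le (hw : MemLp w 2) {a : ℝ} (φ : 𝓢(ℝ, ℂ))
    {u : ℕ → ENNReal} {c : ENNReal}
    (hu : ∀ᶠ n : ℕ in atTop, eLpNorm (fun ξ => (𝓕 ((Set.Icc (-(n : ℝ)) n).indicator w) ξ -
      𝓕 ((Set.Icc (-a) a).indicator w) ξ) * 𝓕 (φ : ℝ → ℂ) ξ) 2 volume ≤ u n)
    (hc : Tendsto u atTop (𝓝 c)) :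
    eLpNorm (conv ((Set.Icc (-a) a)ᶜ.indicator w) φ) 2 volume ≤ c := by
  have hφ := φ.memLp 2 volume
  have hm : ∀ b : ℝ, MemLp ((Set.Icc (-b) b).indicator w) 2 :=
    fun b => hw.indicator measurableSet_Icc
  have hk : MemLp ((Set.Icc (-a) a)ᶜ.indicator w) 2 := hw.indicator measurableSet_Icc.compl
  have hi := fun b => integrable_indicator_Icc hw b
  have hcompl : ∀ b : ℝ, (Set.Icc (-b) b)ᶜ.indicator w = w - (Set.Icc (-b) b).indicator w :=
    fun b => Set.indicator_compl _ _
  refine eLpNorm_le_of_tendsto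
    (f := fun n : ℕ => conv ((Set.Icc (-(n : ℝ)) n).indicator w - (Set.Icc (-a) a).indicator w) φ)
    (fun n => (continuous_conv ((hm n).sub (hm a)) hφ).aestronglyMeasurable)
    (ae_of_all _ fun t => ?_) (hu.mono fun n hn => ?_) hc
  · refine (tendsto_conv_left (fun n : ℕ => (hm n).sub (hm a)) hk hφ ?_).tendsto_at t
    refine ((tendsto_eLpNorm_indicator_compl_Icc hw).comp tendsto_natCast_atTop_atTop).congr
      fun n => ?_
    rw [Function.comp, ← eLpNorm_neg, hcompl, hcompl]
    congr 1; abel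
  · rw [eLpNorm_conv_schwartzMap ((hi n).sub (hi a))]
    convert hn using 3 with ξ
    congr 1
    simp only [Real.fourier_real_eq, Pi.sub_apply, smul_sub]
    have hF : ∀ b : ℝ, Integrable fun v =>
        Real.fourierChar (-(v * ξ)) • (Set.Icc (-b) b).indicator w v := fun b => by
      have := (Real.fourierIntegral_convergent_iff (μ := volume) (f := (Set.Icc (-b) b).indicator w) ξ).2 (hi b)
      simpa [mul_comm] using this
    exact integral_sub (hF n) (hF a)

/-- Multipliers bounded by `C` make convolution with any tail an operator of norm at most `2C` on
Schwartz functions, hence on `L²` by density. On Schwartz functions the tails tend to zero by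
dominated convergence on the frequency side; the uniform bound extends this to `L²`. -/
theorem tendsto_eLpNorm_conv_tail (hw : MemLp w 2) {C : ℝ} {m : ℝ → ℂ} (hC0 : 0 ≤ C)
    (hC : ∀ a ξ : ℝ, ‖∫ u in (-a)..a, w u * cis (-ξ * u)‖ ≤ C)
    (hm : ∀ᵐ ξ : ℝ, Tendsto (fun a => ∫ u in (-a)..a, w u * cis (-ξ * u)) atTop (𝓝 (m ξ)))
    {r : ℝ → ℂ} (hr : MemLp r 2) :
    MemLp (conv w r) 2 ∧
      Tendsto (fun a : ℝ => eLpNorm (conv ((Set.Icc (-a) a)ᶜ.indicator w) r) 2 volume)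
        atTop (𝓝 0) := by
  have hk : ∀ a : ℝ, MemLp ((Set.Icc (-a) a)ᶜ.indicator w) 2 :=
    fun a => hw.indicator measurableSet_Icc.compl
  have hFm : ∀ a : ℝ, AEStronglyMeasurable (𝓕 ((Set.Icc (-a) a).indicator w)) volume := fun a =>
    (VectorFourier.fourierIntegral_continuous Real.continuous_fourierChar continuous_inner
      (integrable_indicator_Icc hw a)).aestronglyMeasurable
  have hFC : ∀ a : ℝ, ∀ ξ, ‖𝓕 ((Set.Icc (-a) a).indicator w) ξ‖ ≤ C := fun a ξ => by
    rcases le_or_gt 0 a with ha | ha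
    · rw [fourier_indicator_Icc ha]; exact hC a ξ
    · rw [Set.Icc_eq_empty (by linarith)]
      simpa [Real.fourier_real_eq] using hC0
  have hFlim : ∀ᵐ ξ : ℝ, Tendsto (fun a : ℝ => 𝓕 ((Set.Icc (-a) a).indicator w) ξ) atTop
      (𝓝 (m ξ)) := by
    filter_upwards [hm] with ξ hξ
    refine hξ.congr' ?_
    filter_upwards [eventually_ge_atTop 0] with a ha
    rw [fourier_indicator_Icc ha]
  have hmm : AEStronglyMeasurable m volume := aestronglyMeasurable_of_tendsto_ae atTop hFm hFlim
  have hmC : ∀ᵐ ξ : ℝ, ‖m ξ‖ ≤ C := by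
    filter_upwards [hFlim] with ξ hξ
    exact le_of_tendsto hξ.norm (Eventually.of_forall fun a => hFC a ξ)
  have bound : ∀ (a : ℝ) (φ : 𝓢(ℝ, ℂ)), eLpNorm (conv ((Set.Icc (-a) a)ᶜ.indicator w) φ) 2 volume ≤
      ENNReal.ofReal (C + C) * eLpNorm φ 2 volume := fun a φ => by
    refine eLpNorm_conv_tail_schwartzMap_le hw φ (Eventually.of_forall fun n => ?_)
      tendsto_const_nhds
    rw [← eLpNorm_fourier_schwartzMap]
    refine eLpNorm_le_mul_eLpNorm_of_ae_le_mul (ae_of_all _ fun ξ => ?_) 2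
    rw [norm_mul]
    gcongr
    exact (norm_sub_le _ _).trans (add_le_add (hFC _ _) (hFC _ _))
  have lim : ∀ φ : 𝓢(ℝ, ℂ), Tendsto (fun a : ℝ => eLpNorm (conv ((Set.Icc (-a) a)ᶜ.indicator w) φ)
      2 volume) atTop (𝓝 0) := fun φ => by
    have hφ : AEStronglyMeasurable (𝓕 (φ : ℝ → ℂ)) volume :=
      (𝓕 φ).continuous.aestronglyMeasurable
    have hD : Tendsto (fun a : ℝ => eLpNorm (fun ξ => (𝓕 ((Set.Icc (-a) a).indicator w) ξ - m ξ) *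
        𝓕 (φ : ℝ → ℂ) ξ) 2 volume) atTop (𝓝 0) := by
      refine tendsto_eLpNorm_two_zero_of_dominated (g := fun ξ => (C + C) * ‖𝓕 (φ : ℝ → ℂ) ξ‖)
        (fun a => ((hFm a).sub hmm).mul hφ) (fun a => ?_)
        (((𝓕 φ).memLp 2 volume).norm.const_mul (C + C)) ?_
      · filter_upwards [hmC] with ξ hξ
        rw [norm_mul]
        gcongr
        exact (norm_sub_le _ _).trans (add_le_add (hFC _ _) hξ)
      · filter_upwards [hFlim] with ξ hξ
        simpa using (hξ.sub_const (m ξ)).mul_const (𝓕 (φ : ℝ → ℂ) ξ)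
    refine tendsto_of_tendsto_of_tendsto_of_le_of_le tendsto_const_nhds hD (fun _ => zero_le)
      fun a => ?_
    -- The cut-off multiplier is split through the limit `m`: the part up to `n` disappears as `n →
    -- ∞`, leaving the deviation at `a`.
    have hD' := (hD.comp tendsto_natCast_atTop_atTop).add_const (eLpNorm (fun ξ =>
      (𝓕 ((Set.Icc (-a) a).indicator w) ξ - m ξ) * 𝓕 (φ : ℝ → ℂ) ξ) 2 volume)
    rw [zero_add] at hD'
    refine eLpNorm_conv_tail_schwartzMap_le hw φ (Eventually.of_forall fun n => ?_) hD'
    refine le_trans (le_of_eq ?_) (eLpNorm_sub_le (((hFm n).sub hmm).mul hφ)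
      (((hFm a).sub hmm).mul hφ) one_le_two)
    congr 1; ext ξ
    simp only [Pi.sub_apply]; ring
  have boundL2 : ∀ (a : ℝ) {g : ℝ → ℂ}, MemLp g 2 volume →
      eLpNorm (conv ((Set.Icc (-a) a)ᶜ.indicator w) g) 2 volume ≤
        ENNReal.ofReal (C + C) * eLpNorm g 2 volume := fun a g hg => by
    obtain ⟨φ, hφ⟩ := exists_seq_schwartzMap_tendsto hg
    refine eLpNorm_le_of_tendsto (f := fun n => conv ((Set.Icc (-a) a)ᶜ.indicator w) (φ n))
      (u := fun n => ENNReal.ofReal (C + C) * (eLpNorm (⇑(φ n) - g) 2 volume + eLpNorm g 2 volume))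
      (fun n => (continuous_conv (hk a) ((φ n).memLp 2 volume)).aestronglyMeasurable)
      (ae_of_all _ fun t => (tendsto_conv_right (hk a) (fun n => (φ n).memLp 2 volume) hg
        hφ).tendsto_at t) (Eventually.of_forall fun n => ?_) ?_
    · refine (bound a (φ n)).trans ?_
      gcongr
      have := eLpNorm_add_le (((φ n).memLp 2 volume).sub hg).1 hg.1 one_le_two
      simpa using this
    · have := ENNReal.Tendsto.const_mul (a := ENNReal.ofReal (C + C))
        (hφ.add_const (eLpNorm g 2 volume)) (Or.inr ENNReal.ofReal_ne_top)
      simpa using this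
  refine ⟨⟨(continuous_conv hw hr).aestronglyMeasurable, ?_⟩, ?_⟩
  -- With `a = -1` the interval is empty, so the tail is all of `w`.
  · have h := boundL2 (-1) hr
    rw [Set.Icc_eq_empty (by norm_num), Set.compl_empty, Set.indicator_univ] at h
    exact h.trans_lt (ENNReal.mul_lt_top ENNReal.ofReal_lt_top hr.2)
  rw [ENNReal.tendsto_nhds_zero]
  intro ε hε
  obtain ⟨φ, hφ⟩ := exists_seq_schwartzMap_tendsto hr
  have h1 := ENNReal.Tendsto.const_mul (a := ENNReal.ofReal (C + C)) hφ
    (Or.inr ENNReal.ofReal_ne_top)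
  rw [mul_zero] at h1
  obtain ⟨n, hn⟩ := (ENNReal.tendsto_nhds_zero.1 h1 (ε / 2) (ENNReal.half_pos hε.ne')).exists
  filter_upwards [ENNReal.tendsto_nhds_zero.1 (lim (φ n)) (ε / 2) (ENNReal.half_pos hε.ne')]
    with a ha
  have hφn := (φ n).memLp 2 volume
  have hsplit : conv ((Set.Icc (-a) a)ᶜ.indicator w) r = conv ((Set.Icc (-a) a)ᶜ.indicator w) (φ n) -
      conv ((Set.Icc (-a) a)ᶜ.indicator w) (⇑(φ n) - r) := by
    rw [conv_sub_right (hk a) hφn hr]; abel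
  rw [hsplit]
  refine (eLpNorm_sub_le (continuous_conv (hk a) hφn).aestronglyMeasurable
    (continuous_conv (hk a) (hφn.sub hr)).aestronglyMeasurable one_le_two).trans ?_
  calc _ ≤ ε / 2 + ε / 2 := add_le_add ha ((boundL2 a (hφn.sub hr)).trans hn)
    _ = ε := ENNReal.add_halves ε

end

/-! ### The receive filter and the receive window -/

theorem sq_sinc_le (x : ℝ) : Real.sinc x ^ 2 ≤ 2 * (1 + x ^ 2)⁻¹ := by
  have h1 : Real.sinc x ^ 2 ≤ 1 := (sq_le_one_iff_abs_le_one _).2 (Real.abs_sinc_le_one x)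
  have h2 : x ^ 2 * Real.sinc x ^ 2 ≤ 1 := by
    by_cases hx : x = 0
    · simp [hx]
    · rw [Real.sinc_of_ne_zero hx, ← mul_pow, mul_div_cancel₀ _ hx]
      exact Real.sin_sq_le_one x
  rw [← div_eq_mul_inv, le_div_iff₀ (by positivity)]
  linarith

@[fun_prop] theorem continuous_w3 (B T : ℝ) : Continuous (w3 B T) := by unfold w3; fun_prop

@[fun_prop] theorem continuous_w4 (T : ℝ) : Continuous (w4 T) := by unfold w4; fun_prop

theorem memLp_w3 {B : ℝ} (hB : 0 < B) (T : ℝ) : MemLp (w3 B T) 2 := by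
  have hm := (continuous_w3 B T).aestronglyMeasurable (μ := volume)
  refine (memLp_two_iff_integrable_sq_norm hm).2 ?_
  have h := (integrable_inv_one_add_sq.comp_mul_left' (R := Real.pi * B)
    (mul_pos Real.pi_pos hB).ne').const_mul (B * 2)
  refine h.mono' (hm.norm.pow 2) (ae_of_all _ fun t => ?_)
  rw [w3, norm_pow, norm_norm, norm_mul, norm_cis, mul_one, Complex.norm_real, Real.norm_eq_abs,
    sq_abs, mul_pow, Real.sq_sqrt hB.le, nsinc, mul_assoc B 2, mul_assoc Real.pi]
  gcongr
  exact sq_sinc_le _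

theorem integral_w3_mul_cis (B T a ξ : ℝ) :
    ∫ u in (-a)..a, w3 B T u * cis (-ξ * u) = sincFourier B a ((B - 1 / T) / 2 - ξ) := by
  refine intervalIntegral.integral_congr fun u _ => ?_
  simp only [w3]
  rw [mul_assoc, ← cis_add]
  congr 2; ring

theorem memLp_conv_w3 {B : ℝ} (hB : 0 < B) (T : ℝ) {r : ℝ → ℂ} (hr : MemLp r 2) :
    MemLp (conv (w3 B T) r) 2 ∧
      Tendsto (fun a : ℝ => eLpNorm (conv ((Set.Icc (-a) a)ᶜ.indicator (w3 B T)) r) 2 volume)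
        atTop (𝓝 0) := by
  obtain ⟨C, hC0, hC⟩ := exists_norm_sincFourier_le hB
  refine tendsto_eLpNorm_conv_tail (m := fun ξ => (Set.Ico (-(B / 2)) (B / 2)).indicator
    (fun _ => ((1 / Real.sqrt B : ℝ) : ℂ)) ((B - 1 / T) / 2 - ξ)) (memLp_w3 hB T) hC0 ?_ ?_ hr
  · intro a ξ
    rw [integral_w3_mul_cis]; exact hC _ _
  · simp only [integral_w3_mul_cis]
    have h : ∀ c : ℝ, ∀ᵐ ξ : ℝ, ξ ≠ c := fun c => by simp [ae_iff]
    filter_upwards [h ((B - 1 / T) / 2 - B / 2), h ((B - 1 / T) / 2 + B / 2)] with ξ h1 h2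
    refine tendsto_sincFourier hB (fun h => h1 ?_) fun h => h2 ?_ <;> linarith

/-- The phase `e^{-jπνT}` moves the symmetric window around `0` to `[0, T)`. -/
theorem integral_w4_mul_cis {b : ℝ} (hb : 0 ≤ b) (T t : ℝ) :
    ∫ v in Set.Icc (-b) b, w4 T v * cis (v * t) = sincFourier T b (t - T / 2) := by
  rw [integral_Icc_eq_integral_Ioc, ← intervalIntegral.integral_of_le (by linarith)]
  refine intervalIntegral.integral_congr fun v _ => ?_
  simp only [w4]
  rw [mul_assoc, ← cis_add, mul_comm v T]
  congr 2; ring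

theorem tendsto_sincFourier_W4 {T t : ℝ} (hT : 0 < T) (h0 : t ≠ 0) (h1 : t ≠ T) :
    Tendsto (fun b => sincFourier T b (t - T / 2)) atTop (𝓝 (W4 T t)) := by
  convert tendsto_sincFourier (x := t - T / 2) hT (fun h => h1 (by linarith))
    (fun h => h0 (by linarith)) using 2
  have : t ∈ Set.Ico 0 T ↔ t - T / 2 ∈ Set.Ico (-(T / 2)) (T / 2) := by
    simp only [Set.mem_Ico]
    constructor <;> rintro ⟨h, h'⟩ <;> constructor <;> linarith
  rw [W4]
  by_cases h : t ∈ Set.Ico 0 T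
  · rw [Set.indicator_of_mem h, Set.indicator_of_mem (this.1 h)]
  · rw [Set.indicator_of_notMem h, Set.indicator_of_notMem (mt this.2 h)]

theorem continuous_sincFourier {β : ℝ} (hβ : 0 < β) (b : ℝ) : Continuous (sincFourier β b) := by
  have := continuous_sineIntegral
  simp only [funext (sincFourier_eq hβ b)]
  fun_prop

theorem measurable_W4 (T : ℝ) : Measurable (W4 T) :=
  measurable_const.indicator measurableSet_Ico

/-- The signal filtered by the truncation of `w₃` to `[-a, a]` and windowed by the Fourier
integral of `w₄` over `[-b, b]`. -/
noncomputable def truncSignal (B T : ℝ) (r : ℝ → ℂ) (R : ℝ × ℝ) (t : ℝ) : ℂ :=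
  conv ((Set.Icc (-R.1) R.1).indicator (w3 B T)) r t * sincFourier T R.2 (t - T / 2)

theorem rxSignal_eq (B T : ℝ) (r : ℝ → ℂ) (t : ℝ) :
    rxSignal B T r t = W4 T t * conv (w3 B T) r t := rfl

theorem aestronglyMeasurable_truncSignal {B T : ℝ} (hB : 0 < B) (hT : 0 < T) {r : ℝ → ℂ}
    (hr : MemLp r 2) (R : ℝ × ℝ) : AEStronglyMeasurable (truncSignal B T r R) volume := by
  have h1 := continuous_conv ((memLp_w3 hB T).indicator (measurableSet_Icc (a := -R.1) (b := R.1))) hr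
  have h2 := continuous_sincFourier hT R.2
  have : Continuous (truncSignal B T r R) := by unfold truncSignal; fun_prop
  exact this.aestronglyMeasurable

theorem aestronglyMeasurable_rxSignal {B T : ℝ} (hB : 0 < B) {r : ℝ → ℂ}
    (hr : MemLp r 2) : AEStronglyMeasurable (rxSignal B T r) volume :=
  (measurable_W4 T).aestronglyMeasurable.mul
    (continuous_conv (memLp_w3 hB T) hr).aestronglyMeasurable

/-- The error is (window error) × (full convolution) minus (convolution tail) × (truncated window).
The first term depends on `R.2` alone, the second is at most a constant times a quantity depending
on `R.1` alone, so the two truncations may be removed independently. -/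
theorem tendsto_truncSignal {B T : ℝ} (hB : 0 < B) (hT : 0 < T) {r : ℝ → ℂ} (hr : MemLp r 2) :
    Tendsto (fun R => eLpNorm (truncSignal B T r R - rxSignal B T r) 2 volume)
      (atTop ×ˢ atTop) (𝓝 0) := by
  obtain ⟨C, hC0, hC⟩ := exists_norm_sincFourier_le hT
  obtain ⟨hy, hk⟩ := memLp_conv_w3 hB T hr
  have hVm : ∀ b, AEStronglyMeasurable (fun t => sincFourier T b (t - T / 2)) volume := fun b =>
    ((continuous_sincFourier hT b).comp (continuous_sub_right _)).aestronglyMeasurable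
  have hlim : ∀ᵐ t : ℝ, Tendsto (fun b => sincFourier T b (t - T / 2)) atTop (𝓝 (W4 T t)) := by
    have h : ∀ c : ℝ, ∀ᵐ ξ : ℝ, ξ ≠ c := fun c => by simp [ae_iff]
    filter_upwards [h 0, h T] with t h0 h1 using tendsto_sincFourier_W4 hT h0 h1
  have h1 : Tendsto (fun b : ℝ => eLpNorm (fun t => (sincFourier T b (t - T / 2) - W4 T t) *
      conv (w3 B T) r t) 2 volume) atTop (𝓝 0) := by
    refine tendsto_eLpNorm_two_zero_of_dominated (g := fun t => (C + C) * ‖conv (w3 B T) r t‖)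
      (fun b => ((hVm b).sub (measurable_W4 T).aestronglyMeasurable).mul hy.1) (fun b => ?_)
      (hy.norm.const_mul (C + C)) ?_
    · filter_upwards [hlim] with t ht
      rw [norm_mul]
      gcongr
      exact (norm_sub_le _ _).trans (add_le_add (hC _ _)
        (le_of_tendsto ht.norm (Eventually.of_forall fun b => hC b _)))
    · filter_upwards [hlim] with t ht
      simpa using (ht.sub_const (W4 T t)).mul_const (conv (w3 B T) r t)
  have h2 := ENNReal.Tendsto.const_mul (a := ENNReal.ofReal C) hk (Or.inr ENNReal.ofReal_ne_top)
  rw [mul_zero] at h2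
  have h3 := (h2.comp (tendsto_fst (f := (atTop : Filter ℝ)) (g := (atTop : Filter ℝ)))).add
    (h1.comp (tendsto_snd (f := (atTop : Filter ℝ)) (g := (atTop : Filter ℝ))))
  rw [add_zero] at h3
  refine tendsto_of_tendsto_of_tendsto_of_le_of_le tendsto_const_nhds h3 (fun _ => zero_le)
    fun R => ?_
  have hw := memLp_w3 hB T
  have hkm := continuous_conv (hw.indicator (measurableSet_Icc (a := -R.1) (b := R.1)).compl) hr
  have hsplit : truncSignal B T r R - rxSignal B T r =
      (fun t => (sincFourier T R.2 (t - T / 2) - W4 T t) * conv (w3 B T) r t) -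
      fun t => conv ((Set.Icc (-R.1) R.1)ᶜ.indicator (w3 B T)) r t *
        sincFourier T R.2 (t - T / 2) := by
    ext t
    have : (Set.Icc (-R.1) R.1).indicator (w3 B T) =
        w3 B T - (Set.Icc (-R.1) R.1)ᶜ.indicator (w3 B T) := by
      rw [Set.indicator_compl]; abel
    rw [Pi.sub_apply, Pi.sub_apply, truncSignal, rxSignal_eq, this,
      conv_sub_left hw (hw.indicator measurableSet_Icc.compl) hr, Pi.sub_apply]
    ring
  rw [hsplit]
  refine (eLpNorm_sub_le (((hVm R.2).sub (measurable_W4 T).aestronglyMeasurable).mul hy.1)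
    (hkm.aestronglyMeasurable.mul (hVm R.2)) one_le_two).trans ?_
  rw [add_comm]
  refine add_le_add (eLpNorm_le_mul_eLpNorm_of_ae_le_mul (ae_of_all _ fun t => ?_) 2) le_rfl
  rw [Pi.mul_apply, norm_mul, mul_comm]
  gcongr
  exact hC _ _

/-! ### Partial sums of the Zak transform -/

/-- The partial sum over `n ∈ s` of the Zak transform of `a`. -/
noncomputable def zakSum (τp : ℝ) (a : ℝ → ℂ) (s : Finset ℤ) (z : ℝ × ℝ) : ℂ :=
  (Real.sqrt τp : ℂ) * ∑ n ∈ s, a (z.1 + n * τp) * cis (-(n * z.2 * τp))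

/-- The box made of `(2 L)²` fundamental cells around the origin. -/
def zakBox (τp : ℝ) (L : ℕ) : Set (ℝ × ℝ) :=
  Set.Ico (-(L * τp)) (L * τp) ×ˢ Set.Ico (-(L / τp)) (L / τp)

theorem measurableSet_zakBox (τp : ℝ) (L : ℕ) : MeasurableSet (zakBox τp L) :=
  measurableSet_Ico.prod measurableSet_Ico

theorem zakBox_mono {τp : ℝ} (hτ : 0 < τp) {L L' : ℕ} (h : L ≤ L') :
    zakBox τp L ⊆ zakBox τp L' := by
  have h' : (L : ℝ) ≤ L' := by exact_mod_cast h
  have h1 : (L : ℝ) * τp ≤ L' * τp := by gcongr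
  have h2 : (L : ℝ) / τp ≤ L' / τp := by gcongr
  exact Set.prod_mono (Set.Ico_subset_Ico (by linarith) h1) (Set.Ico_subset_Ico (by linarith) h2)

theorem IsCompact.exists_subset_zakBox {τp : ℝ} (hτ : 0 < τp) {S : Set (ℝ × ℝ)}
    (hS : IsCompact S) : ∃ L, S ⊆ zakBox τp L := by
  obtain ⟨R, hR⟩ := hS.isBounded.exists_norm_le
  obtain ⟨L, hL⟩ := exists_nat_gt (max (R / τp) (R * τp))
  refine ⟨L, fun z hz => ?_⟩
  have hz1 := (abs_le.1 ((norm_fst_le z).trans (hR z hz)))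
  have hz2 := (abs_le.1 ((norm_snd_le z).trans (hR z hz)))
  have h1 : R < L * τp := (div_lt_iff₀ hτ).1 ((le_max_left _ _).trans_lt hL)
  have h2 : R < L / τp := (lt_div_iff₀ hτ).2 ((le_max_right _ _).trans_lt hL)
  exact ⟨⟨by linarith [hz1.1], by linarith [hz1.2]⟩, ⟨by linarith [hz2.1], by linarith [hz2.2]⟩⟩

theorem zakBox_subset_isCompact (τp : ℝ) (L : ℕ) :
    ∃ S, IsCompact S ∧ zakBox τp L ⊆ S :=
  ⟨_, isCompact_Icc.prod isCompact_Icc, Set.prod_mono Set.Ico_subset_Icc_self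
    Set.Ico_subset_Icc_self⟩

theorem iUnion_zakBox {τp : ℝ} (hτ : 0 < τp) : ⋃ L, zakBox τp L = Set.univ := by
  refine Set.eq_univ_of_forall fun z => ?_
  obtain ⟨L, hL⟩ := (isCompact_singleton (x := z)).exists_subset_zakBox hτ
  exact Set.mem_iUnion.2 ⟨L, hL rfl⟩

theorem integral_cis_mul_intCast {τp : ℝ} (hτ : 0 < τp) (L : ℕ) (k : ℤ) :
    ∫ ν in (-(L / τp))..(L / τp), cis (k * ν * τp) =
      if k = 0 then ((2 * L / τp : ℝ) : ℂ) else 0 := by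
  split_ifs with hk
  · simp only [hk, Int.cast_zero, zero_mul, cis_zero, intervalIntegral.integral_const]
    rw [Complex.real_smul, mul_one]; congr 1; ring
  · have hk' : (k : ℂ) ≠ 0 := by exact_mod_cast hk
    have hτ' : (τp : ℂ) ≠ 0 := by exact_mod_cast hτ.ne'
    have hc : (2 * Real.pi * Complex.I * k * τp : ℂ) ≠ 0 := by
      have := Complex.two_pi_I_ne_zero
      simp only [ne_eq, mul_eq_zero, not_or] at this ⊢
      tauto
    have h1 : ∀ ν : ℝ, cis (k * ν * τp) = Complex.exp ((2 * Real.pi * Complex.I * k * τp) * ν) :=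
      fun ν => by rw [cis]; congr 1; push_cast; ring
    have h2 : ∀ m : ℤ, cis (k * (m / τp) * τp) = 1 := fun m => by
      rw [mul_assoc, div_mul_cancel₀ _ hτ.ne']
      exact_mod_cast cis_intCast (k * m)
    simp only [h1]
    rw [integral_exp_mul_complex hc, ← h1, ← h1]
    have e1 := h2 L
    have e2 := h2 (-L)
    push_cast at e1 e2
    rw [neg_div] at e2
    rw [e1, e2]; simp

/-- The interval consists of `2L` full Doppler periods `1/τp`, over which distinct exponentials are
orthogonal. -/
theorem integral_norm_sq_trigPoly {τp : ℝ} (hτ : 0 < τp) (L : ℕ) (s : Finset ℤ) (c : ℤ → ℂ) :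
    ∫ ν in (-(L / τp))..(L / τp), ‖∑ n ∈ s, c n * cis (-(n * ν * τp))‖ ^ 2 =
      2 * L / τp * ∑ n ∈ s, ‖c n‖ ^ 2 := by
  have h1 : ∀ ν : ℝ, ((‖∑ n ∈ s, c n * cis (-(n * ν * τp))‖ ^ 2 : ℝ) : ℂ) =
      ∑ m ∈ s, ∑ n ∈ s, (c m * (starRingEnd ℂ) (c n)) * cis (((n - m : ℤ) : ℝ) * ν * τp) := by
    intro ν
    push_cast
    rw [← Complex.mul_conj', map_sum, Finset.sum_mul_sum]
    refine Finset.sum_congr rfl fun m _ => Finset.sum_congr rfl fun n _ => ?_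
    rw [map_mul, conj_cis, mul_mul_mul_comm, ← cis_add]
    congr 2; ring
  have hi : ∀ k : ℤ, IntervalIntegrable (fun ν : ℝ => cis ((k : ℝ) * ν * τp)) volume
      (-(L / τp)) (L / τp) := fun k => Continuous.intervalIntegrable (by fun_prop) _ _
  have h2 : ((∫ ν in (-(L / τp))..(L / τp), ‖∑ n ∈ s, c n * cis (-(n * ν * τp))‖ ^ 2 : ℝ) : ℂ) =
      ((2 * L / τp * ∑ n ∈ s, ‖c n‖ ^ 2 : ℝ) : ℂ) := by
    rw [← intervalIntegral.integral_ofReal]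
    simp only [h1]
    rw [intervalIntegral.integral_finsetSum fun m _ =>
      Continuous.intervalIntegrable (by fun_prop) _ _]
    rw [Complex.ofReal_mul, Complex.ofReal_sum, Finset.mul_sum]
    refine Finset.sum_congr rfl fun m hm => ?_
    rw [intervalIntegral.integral_finsetSum fun n _ => (hi _).const_mul _]
    simp only [intervalIntegral.integral_const_mul, integral_cis_mul_intCast hτ, sub_eq_zero]
    simp only [mul_ite, mul_zero, Finset.sum_ite_eq', hm, if_true]
    rw [Complex.mul_conj']
    push_cast; ring
  exact_mod_cast h2

theorem lintegral_enorm_sq_zakSum_section {τp : ℝ} (hτ : 0 < τp) (L : ℕ) (a : ℝ → ℂ)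
    (s : Finset ℤ) (τ : ℝ) :
    ∫⁻ ν in Set.Ico (-(L / τp)) (L / τp), ‖zakSum τp a s (τ, ν)‖ₑ ^ 2 =
      2 * L * ∑ n ∈ s, ‖a (τ + n * τp)‖ₑ ^ 2 := by
  have hcont : Continuous fun ν : ℝ =>
      ‖∑ n ∈ s, a (τ + n * τp) * cis (-(n * ν * τp))‖ ^ 2 := by fun_prop
  have hL : (0 : ℝ) ≤ L / τp := by positivity
  have h1 : ∀ ν : ℝ, ‖zakSum τp a s (τ, ν)‖ₑ ^ 2 = ENNReal.ofReal τp *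
      ENNReal.ofReal (‖∑ n ∈ s, a (τ + n * τp) * cis (-(n * ν * τp))‖ ^ 2) := fun ν => by
    rw [zakSum, ← ENNReal.ofReal_mul hτ.le, ← ofReal_norm, ← ENNReal.ofReal_pow (norm_nonneg _),
      norm_mul, mul_pow, Complex.norm_real, Real.norm_eq_abs, sq_abs, Real.sq_sqrt hτ.le]
  have hint := (hcont.integrableOn_Icc (μ := volume) (a := -(L / τp)) (b := L / τp)).mono_set
    Set.Ico_subset_Icc_self
  simp only [h1]
  rw [lintegral_const_mul _ (by fun_prop), ← ofReal_integral_eq_lintegral_ofReal hint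
    (ae_of_all _ fun ν => by positivity), integral_Ico_eq_integral_Ioc,
    ← intervalIntegral.integral_of_le (by linarith),
    integral_norm_sq_trigPoly hτ, ← ENNReal.ofReal_mul hτ.le, ← mul_assoc,
    mul_div_cancel₀ _ hτ.ne', ENNReal.ofReal_mul (by positivity),
    ENNReal.ofReal_sum_of_nonneg (fun _ _ => by positivity), ENNReal.ofReal_mul (by norm_num)]
  simp [ENNReal.ofReal_pow]

theorem aestronglyMeasurable_comp_fst_add {a : ℝ → ℂ} (ha : AEStronglyMeasurable a volume) (c : ℝ) :
    AEStronglyMeasurable (fun z : ℝ × ℝ => a (z.1 + c)) volume :=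
  (ha.comp_quasiMeasurePreserving
    (measurePreserving_add_right volume c).quasiMeasurePreserving).comp_quasiMeasurePreserving
    Measure.quasiMeasurePreserving_fst

theorem aestronglyMeasurable_zakSum (τp : ℝ) {a : ℝ → ℂ} (ha : AEStronglyMeasurable a volume)
    (s : Finset ℤ) : AEStronglyMeasurable (zakSum τp a s) volume := by
  refine AEStronglyMeasurable.const_mul ?_ _
  refine Finset.aestronglyMeasurable_fun_sum _ fun n _ => ?_
  exact (aestronglyMeasurable_comp_fst_add ha _).mul
    (Continuous.aestronglyMeasurable (by fun_prop))

/-- Mean square of a partial sum over a box, by orthogonality of the exponentials. -/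
theorem eLpNorm_zakSum_sq {τp : ℝ} (hτ : 0 < τp) (L : ℕ) {a : ℝ → ℂ}
    (ha : AEStronglyMeasurable a volume) (s : Finset ℤ) :
    eLpNorm (zakSum τp a s) 2 (volume.restrict (zakBox τp L)) ^ 2 =
      2 * L * ∑ n ∈ s, ∫⁻ τ in Set.Ico (-(L * τp)) (L * τp), ‖a (τ + n * τp)‖ₑ ^ 2 := by
  have hm : ∀ n : ℤ, AEMeasurable (fun τ => ‖a (τ + n * τp)‖ₑ ^ 2)
      (volume.restrict (Set.Ico (-(L * τp)) (L * τp))) := fun n =>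
    ((ha.comp_quasiMeasurePreserving
      (measurePreserving_add_right volume (n * τp)).quasiMeasurePreserving).enorm.pow_const
        2).restrict
  rw [eLpNorm_two_sq, zakBox, Measure.volume_eq_prod, ← Measure.prod_restrict, lintegral_prod]
  · simp only [lintegral_enorm_sq_zakSum_section hτ]
    rw [lintegral_const_mul' _ _ (by finiteness), lintegral_finsetSum' _ fun n _ => hm n]
  · rw [Measure.prod_restrict, ← Measure.volume_eq_prod]
    exact ((aestronglyMeasurable_zakSum τp ha s).enorm.pow_const 2).restrict

/-- A half-open interval of length `2Lτp` meets a progression of step `τp` in at most `2L` points.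
-/
theorem sum_indicator_Ico_le {τp : ℝ} (hτ : 0 < τp) (L : ℕ) (s : Finset ℤ) (t : ℝ) :
    ∑ n ∈ s, (Set.Ico (-(L * τp)) (L * τp)).indicator (1 : ℝ → ENNReal) (t - n * τp) ≤
      2 * L := by
  classical
  simp only [Set.indicator_apply, Pi.one_apply]
  rw [Finset.sum_boole]
  have hsub : (s.filter fun n : ℤ => t - n * τp ∈ Set.Ico (-(L * τp)) (L * τp)) ⊆
      Finset.Ioc (⌊t / τp⌋ - L) (⌊t / τp⌋ + L) := by
    intro n hn
    obtain ⟨-, h1, h2⟩ := Finset.mem_filter.1 hn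
    have h3 : (n : ℝ) - L ≤ t / τp := by rw [le_div_iff₀ hτ]; linarith
    have h4 : t / τp < (n : ℝ) + L := by rw [div_lt_iff₀ hτ]; linarith
    have h5 : n - L ≤ ⌊t / τp⌋ := Int.le_floor.2 (by push_cast; exact h3)
    have h6 : ⌊t / τp⌋ < n + L := Int.floor_lt.2 (by push_cast; exact h4)
    rw [Finset.mem_Ioc]; omega
  have hc := Finset.card_le_card hsub
  rw [Int.card_Ioc] at hc
  have : (s.filter fun n : ℤ => t - n * τp ∈ Set.Ico (-(L * τp)) (L * τp)).card ≤ 2 * L := by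
    omega
  exact_mod_cast this

theorem sum_lintegral_shift_le {τp : ℝ} (hτ : 0 < τp) (L : ℕ) {a : ℝ → ℂ}
    (ha : AEStronglyMeasurable a volume) (s : Finset ℤ) :
    ∑ n ∈ s, ∫⁻ τ in Set.Ico (-(L * τp)) (L * τp), ‖a (τ + n * τp)‖ₑ ^ 2 ≤
      2 * L * eLpNorm a 2 volume ^ 2 := by
  have hS : MeasurableSet (Set.Ico (-(L * τp)) (L * τp)) := measurableSet_Ico
  have h1 : ∀ n : ℤ, ∫⁻ τ in Set.Ico (-(L * τp)) (L * τp), ‖a (τ + n * τp)‖ₑ ^ 2 =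
      ∫⁻ t, (Set.Ico (-(L * τp)) (L * τp)).indicator 1 (t - n * τp) * ‖a t‖ₑ ^ 2 := by
    intro n
    rw [← lintegral_indicator hS, ← lintegral_sub_right_eq_self _ ((n : ℝ) * τp)]
    refine lintegral_congr fun t => ?_
    by_cases h : t - n * τp ∈ Set.Ico (-(L * τp)) (L * τp)
    · rw [Set.indicator_of_mem h, Set.indicator_of_mem h, sub_add_cancel, Pi.one_apply, one_mul]
    · rw [Set.indicator_of_notMem h, Set.indicator_of_notMem h, zero_mul]
  simp only [h1]
  rw [← lintegral_finsetSum' _ fun n _ => ?_]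
  · rw [eLpNorm_two_sq, ← lintegral_const_mul' _ _ (by finiteness)]
    refine lintegral_mono fun t => ?_
    rw [← Finset.sum_mul]
    gcongr
    exact sum_indicator_Ico_le hτ L s t
  · refine AEMeasurable.mul (Measurable.aemeasurable ?_) (ha.enorm.pow_const 2)
    exact (measurable_one.indicator hS).comp (measurable_id.sub_const _)

/-- One factor `2L` in the square counts Doppler periods, the other the overlaps of the shifted
delay intervals. The bound is independent of `s`. -/
theorem eLpNorm_zakSum_le {τp : ℝ} (hτ : 0 < τp) (L : ℕ) {a : ℝ → ℂ}
    (ha : AEStronglyMeasurable a volume) (s : Finset ℤ) :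
    eLpNorm (zakSum τp a s) 2 (volume.restrict (zakBox τp L)) ≤
      2 * L * eLpNorm a 2 volume := by
  refine (ENNReal.pow_le_pow_left_iff two_ne_zero).1 ?_
  rw [eLpNorm_zakSum_sq hτ L ha, mul_pow, pow_two (2 * (L : ENNReal)), mul_assoc (2 * (L : ENNReal))]
  gcongr
  exact sum_lintegral_shift_le hτ L ha s

/-! ### Existence of the Zak transform -/

/-- Gluing along nested boxes: each point takes the value belonging to the smallest box containing
it. -/
theorem exists_ae_eq_of_ae_eq_zakBox {τp : ℝ} (hτ : 0 < τp) (G : ℕ → ℝ × ℝ → ℂ)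
    (h : ∀ m L, m ≤ L → G L =ᵐ[volume.restrict (zakBox τp m)] G m) :
    ∃ H : ℝ × ℝ → ℂ, ∀ L, H =ᵐ[volume.restrict (zakBox τp L)] G L := by
  classical
  have hex : ∀ z : ℝ × ℝ, ∃ L, z ∈ zakBox τp L := fun z => by
    have := iUnion_zakBox hτ ▸ Set.mem_univ z
    exact Set.mem_iUnion.1 this
  refine ⟨fun z => G (Nat.find (hex z)) z, fun L => ?_⟩
  rw [EventuallyEq, ae_restrict_iff' (measurableSet_zakBox _ _)]
  have h' : ∀ᵐ z : ℝ × ℝ, ∀ m, m ≤ L → z ∈ zakBox τp m → G L z = G m z := by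
    rw [ae_all_iff]
    intro m
    by_cases hm : m ≤ L
    · filter_upwards [(ae_restrict_iff' (measurableSet_zakBox _ _)).1 (h m L hm)] with z hz _ using hz
    · exact ae_of_all _ fun z hz => absurd hz hm
  filter_upwards [h'] with z hz hzL
  exact (hz _ (Nat.find_min' (hex z) hzL) (Nat.find_spec (hex z))).symm

theorem exists_tendsto_zakSum {τp : ℝ} (hτ : 0 < τp) {a : ℝ → ℂ} (ha : MemLp a 2) (L : ℕ) :
    ∃ G : ℝ × ℝ → ℂ, AEStronglyMeasurable G (volume.restrict (zakBox τp L)) ∧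
      Tendsto (fun s => eLpNorm (zakSum τp a s - G) 2 (volume.restrict (zakBox τp L)))
        atTop (𝓝 0) := by
  have hmem : ∀ s, MemLp (zakSum τp a s) 2 (volume.restrict (zakBox τp L)) := fun s =>
    ⟨(aestronglyMeasurable_zakSum τp ha.1 s).restrict, (eLpNorm_zakSum_le hτ L ha.1 s).trans_lt
      (ENNReal.mul_lt_top (by finiteness) ha.2)⟩
  set b : ℤ → ENNReal := fun n =>
    ∫⁻ τ in Set.Ico (-(L * τp)) (L * τp), ‖a (τ + n * τp)‖ₑ ^ 2 with hb
  have hbsum : ∑' n, b n ≠ ⊤ := by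
    refine ne_top_of_le_ne_top ?_ (ENNReal.summable.tsum_le_of_sum_le fun s =>
      sum_lintegral_shift_le hτ L ha.1 s)
    exact ENNReal.mul_ne_top (by finiteness) (ENNReal.pow_ne_top ha.2.ne)
  set F : ℤ → Lp ℂ 2 (volume.restrict (zakBox τp L)) := fun n => (hmem {n}).toLp _ with hF
  have hsum : ∀ s : Finset ℤ, ∑ n ∈ s, F n = (hmem s).toLp _ := by
    intro s
    induction s using Finset.induction_on with
    | empty =>
      rw [Finset.sum_empty, eq_comm, Lp.eq_zero_iff_ae_eq_zero]
      filter_upwards [(hmem ∅).coeFn_toLp] with z hz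
      rw [hz]; simp [zakSum]
    | insert n s hn ih =>
      rw [Finset.sum_insert hn, ih, ← MemLp.toLp_add]
      congr 1; ext z
      simp [zakSum, Finset.sum_insert hn, mul_add]
  have hsummable : Summable F := by
    rw [summable_iff_vanishing_norm]
    intro ε hε
    -- By orthogonality the squared norm of a block of terms is `2L` times the block sum of `b`, so
    -- a tail of the convergent series `∑ b n` controls every block disjoint from `s`.
    have h1 := ENNReal.tendsto_tsum_compl_atTop_zero hbsum
    have h2 := ENNReal.Tendsto.const_mul (a := 2 * (L : ENNReal)) h1 (Or.inr (by finiteness))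
    rw [mul_zero] at h2
    obtain ⟨s, hs⟩ := (h2.eventually_lt_const
      (show 0 < ENNReal.ofReal ε ^ 2 from ENNReal.pow_pos (ENNReal.ofReal_pos.2 hε) 2)).exists
    refine ⟨s, fun t ht => ?_⟩
    rw [hsum, Lp.norm_toLp]
    refine (ENNReal.toReal_lt_toReal (hmem t).2.ne ENNReal.ofReal_ne_top).2 ?_ |>.trans_eq
      (ENNReal.toReal_ofReal hε.le)
    refine (ENNReal.pow_lt_pow_left_iff two_ne_zero).1 (lt_of_le_of_lt ?_ hs)
    rw [eLpNorm_zakSum_sq hτ L ha.1]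
    gcongr
    have hd : ∀ n ∈ t, (fun n => n ∉ s) n := fun n hn hns => Finset.disjoint_left.1 ht hn hns
    have := ENNReal.sum_le_tsum (f := fun n : {n // n ∉ s} => b n) (t.subtype (· ∉ s))
    rwa [Finset.sum_subtype_of_mem b hd] at this
  obtain ⟨G, hG⟩ := hsummable
  refine ⟨G, (Lp.memLp G).1, ?_⟩
  have := (Lp.tendsto_Lp_iff_tendsto_eLpNorm' _ _).1 hG
  refine this.congr fun s => eLpNorm_congr_ae ?_
  rw [hsum]
  exact (hmem s).coeFn_toLp.sub EventuallyEq.rfl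

theorem ae_eq_of_tendsto_eLpNorm_sub {α ι : Type*} {_ : MeasurableSpace α} {μ : Measure α}
    {l : Filter ι} [l.NeBot] {F : ι → α → ℂ} {G H : α → ℂ}
    (hF : ∀ᶠ i in l, AEStronglyMeasurable (F i) μ) (hG : AEStronglyMeasurable G μ)
    (hH : AEStronglyMeasurable H μ)
    (h1 : Tendsto (fun i => eLpNorm (F i - G) 2 μ) l (𝓝 0))
    (h2 : Tendsto (fun i => eLpNorm (F i - H) 2 μ) l (𝓝 0)) : G =ᵐ[μ] H := by
  have h3 : eLpNorm (G - H) 2 μ ≤ 0 := by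
    have h4 := h2.add h1
    rw [add_zero] at h4
    refine ge_of_tendsto h4 (hF.mono fun i hi => ?_)
    have := eLpNorm_sub_le (hi.sub hH) (hi.sub hG) (p := 2) one_le_two
    simpa using this
  have h5 := (eLpNorm_eq_zero_iff (hG.sub hH) two_ne_zero).1 (le_antisymm h3 zero_le)
  filter_upwards [h5] with x hx
  exact sub_eq_zero.1 hx

theorem exists_isZakTransform {τp : ℝ} (hτ : 0 < τp) {a : ℝ → ℂ} (ha : MemLp a 2) :
    ∃ A, IsZakTransform τp a A := by
  choose G hGm hG using exists_tendsto_zakSum hτ ha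
  obtain ⟨H, hH⟩ := exists_ae_eq_of_ae_eq_zakBox hτ G fun m L hmL => by
    have hle : volume.restrict (zakBox τp m) ≤ volume.restrict (zakBox τp L) :=
      Measure.restrict_mono_set _ (zakBox_mono hτ hmL)
    refine ae_eq_of_tendsto_eLpNorm_sub (l := atTop)
      (Eventually.of_forall fun s => (aestronglyMeasurable_zakSum τp ha.1 s).restrict)
      ((hGm L).mono_measure hle) (hGm m) ?_ (hG m)
    exact tendsto_of_tendsto_of_tendsto_of_le_of_le tendsto_const_nhds (hG L) (fun _ => zero_le)
      fun s => eLpNorm_mono_measure _ hle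
  refine ⟨H, ?_, fun S hS => ?_⟩
  · rw [← Measure.restrict_univ (μ := (volume : Measure (ℝ × ℝ))), ← iUnion_zakBox hτ,
      aestronglyMeasurable_iUnion_iff]
    exact fun L => (hGm L).congr (hH L).symm
  · obtain ⟨L, hL⟩ := hS.exists_subset_zakBox hτ
    refine tendsto_of_tendsto_of_tendsto_of_le_of_le tendsto_const_nhds (hG L) (fun _ => zero_le)
      fun s => (eLpNorm_mono_measure _ (Measure.restrict_mono_set _ hL)).trans_eq ?_
    refine eLpNorm_congr_ae ?_
    filter_upwards [hH L] with z hz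
    rw [hz]; rfl

/-! ### The truncated twisted convolution -/

/-- The algebraic core. In each term the phase of `wrx`, that of the series and the twist multiply
to `cis (-(n * ν * τp)) * cis (ν' * (τ + n * τp))`, free of any `τ'`–`ν'` coupling, so the integral
factors. The sign of `R.2` matters because `sincFourier` uses an oriented integral. -/
theorem twistedConvTrunc_zakSum {B T : ℝ} (τp : ℝ) {r : ℝ → ℂ} (hr : MemLp r 2) (s : Finset ℤ)
    {R : ℝ × ℝ} (hR : 0 ≤ R.2) (z : ℝ × ℝ) :
    twistedConvTrunc (wrx B T) (zakSum τp r s) R z = zakSum τp (truncSignal B T r R) s z := by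
  have h1 : ∀ z' : ℝ × ℝ, wrx B T z' * zakSum τp r s (z - z') * cis (z'.2 * (z.1 - z'.1)) =
      ∑ n ∈ s, (Real.sqrt τp * cis (-(n * z.2 * τp))) *
        ((w3 B T z'.1 * r (z.1 + n * τp - z'.1)) * (w4 T z'.2 * cis (z'.2 * (z.1 + n * τp)))) := by
    intro z'
    simp only [wrx, zakSum, Finset.mul_sum, Finset.sum_mul, Prod.fst_sub, Prod.snd_sub]
    refine Finset.sum_congr rfl fun n _ => ?_
    have e1 : cis (z'.2 * z'.1) * cis (-(n * (z.2 - z'.2) * τp)) * cis (z'.2 * (z.1 - z'.1)) =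
        cis (-(n * z.2 * τp)) * cis (z'.2 * (z.1 + n * τp)) := by
      simp only [← cis_add]; congr 1; ring
    have e2 : z.1 - z'.1 + n * τp = z.1 + n * τp - z'.1 := by ring
    rw [e2]
    linear_combination (w3 B T z'.1 * w4 T z'.2 * Real.sqrt τp * r (z.1 + n * τp - z'.1)) * e1
  have hi1 : ∀ t : ℝ, IntegrableOn (fun u => w3 B T u * r (t - u)) (Set.Icc (-R.1) R.1) := fun t =>
    IntegrableOn.continuousOn_mul (continuous_w3 B T).continuousOn
      (((memLp_two_comp_sub hr t).locallyIntegrable one_le_two).integrableOn_isCompact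
        isCompact_Icc) isCompact_Icc
  have hi2 : ∀ t : ℝ, IntegrableOn (fun v => w4 T v * cis (v * t)) (Set.Icc (-R.2) R.2) := fun t =>
    Continuous.integrableOn_Icc (by fun_prop)
  rw [twistedConvTrunc]
  simp only [h1]
  rw [Measure.volume_eq_prod, ← Measure.prod_restrict, integral_finsetSum _ fun n _ =>
    ((hi1 _).mul_prod (hi2 _)).const_mul _, zakSum, Finset.mul_sum]
  refine Finset.sum_congr rfl fun n _ => ?_
  rw [integral_const_mul, 
    integral_prod_mul (fun u => w3 B T u * r (z.1 + n * τp - u))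
      (fun v => w4 T v * cis (v * (z.1 + n * τp))), integral_w4_mul_cis hR, truncSignal, conv_apply,
    ← integral_indicator measurableSet_Icc]
  have e3 : ∀ u : ℝ, (Set.Icc (-R.1) R.1).indicator (fun u => w3 B T u * r (z.1 + n * τp - u)) u =
      (Set.Icc (-R.1) R.1).indicator (w3 B T) u * r (z.1 + n * τp - u) := fun u =>
    Set.indicator_mul_left _ _ _
  simp only [e3]
  ring

theorem memLp_zakSum_zakBox {τp : ℝ} (hτ : 0 < τp) {a : ℝ → ℂ} (ha : MemLp a 2) (s : Finset ℤ)
    (L : ℕ) : MemLp (zakSum τp a s) 2 (volume.restrict (zakBox τp L)) :=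
  ⟨(aestronglyMeasurable_zakSum τp ha.1 s).restrict, (eLpNorm_zakSum_le hτ L ha.1 s).trans_lt
    (ENNReal.mul_lt_top (by finiteness) ha.2)⟩

theorem tendsto_setIntegral_mul_comp_sub {ι : Type*} {l : Filter ι} {Q : Set (ℝ × ℝ)}
    (hQ : IsCompact Q) {κ : ℝ × ℝ → ℂ} (hκ : Continuous κ) {F : ι → ℝ × ℝ → ℂ} {A : ℝ × ℝ → ℂ}
    (z : ℝ × ℝ) (hF : ∀ s, MemLp (F s) 2 (volume.restrict ((fun z' => z - z') ⁻¹' Q)))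
    (hA : MemLp A 2 (volume.restrict ((fun z' => z - z') ⁻¹' Q)))
    (hlim : Tendsto (fun s => eLpNorm (F s - A) 2
      (volume.restrict ((fun z' => z - z') ⁻¹' Q))) l (𝓝 0)) :
    Tendsto (fun s => ∫ z' in Q, κ z' * F s (z - z')) l (𝓝 (∫ z' in Q, κ z' * A (z - z'))) := by
  have hQm : MeasurableSet Q := hQ.measurableSet
  have hvol : volume Q ≠ ⊤ := hQ.measure_lt_top.ne
  have : IsFiniteMeasure (volume.restrict Q) := ⟨by simpa using hvol.lt_top⟩
  obtain ⟨C, hC⟩ := hQ.exists_bound_of_continuousOn hκ.continuousOn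
  have hC' := (ae_restrict_iff' (μ := volume) hQm).2 (ae_of_all _ hC)
  have hmp : MeasurePreserving (fun z' => z - z') (volume.restrict Q)
      (volume.restrict ((fun z' => z - z') ⁻¹' Q)) := by
    have := (Measure.measurePreserving_sub_left (volume : Measure (ℝ × ℝ)) z).restrict_preimage
      (s := (fun z' => z - z') ⁻¹' Q) (hQm.preimage (by fun_prop))
    rwa [← Set.preimage_comp, show (fun z' => z - z') ∘ (fun z' => z - z') = id from
      funext fun _ => by simp, Set.preimage_id] at this
  have hint : ∀ G : ℝ × ℝ → ℂ, MemLp G 2 (volume.restrict ((fun z' => z - z') ⁻¹' Q)) →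
      Integrable (fun z' => κ z' * G (z - z')) (volume.restrict Q) := fun G hG =>
    ((hG.comp_measurePreserving hmp).integrable one_le_two).bdd_mul hκ.aestronglyMeasurable hC'
  refine tendsto_integral_of_L1 _ (hint A hA).1 (Eventually.of_forall fun s => hint _ (hF s)) ?_
  have hup := ENNReal.Tendsto.mul_const (b := volume.restrict Q Set.univ ^ (1 / 2 : ℝ))
    (ENNReal.Tendsto.const_mul (a := ENNReal.ofReal C) hlim (Or.inr ENNReal.ofReal_ne_top))
    (Or.inr (ENNReal.rpow_ne_top_of_nonneg (by norm_num) (measure_ne_top _ _)))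
  rw [mul_zero, zero_mul] at hup
  refine tendsto_of_tendsto_of_tendsto_of_le_of_le tendsto_const_nhds hup (fun _ => zero_le)
    fun s => ?_
  have hD := ((hF s).sub hA).comp_measurePreserving hmp
  have h1 : ∫⁻ z' in Q, ‖κ z' * F s (z - z') - κ z' * A (z - z')‖ₑ =
      eLpNorm (fun z' => κ z' * (F s - A) (z - z')) 1 (volume.restrict Q) := by
    rw [eLpNorm_one_eq_lintegral_enorm]; simp only [Pi.sub_apply, mul_sub]
  have h2 : eLpNorm (fun z' => κ z' * (F s - A) (z - z')) 1 (volume.restrict Q) ≤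
      ENNReal.ofReal C * eLpNorm ((F s - A) ∘ fun z' => z - z') 1 (volume.restrict Q) := by
    refine eLpNorm_le_mul_eLpNorm_of_ae_le_mul (hC'.mono fun z' hz' => ?_) 1
    rw [norm_mul]
    exact mul_le_mul_of_nonneg_right hz' (norm_nonneg _)
  have h3 : eLpNorm ((F s - A) ∘ fun z' => z - z') 1 (volume.restrict Q) ≤
      eLpNorm ((F s - A) ∘ fun z' => z - z') 2 (volume.restrict Q) *
        volume.restrict Q Set.univ ^ (1 / 2 : ℝ) := by
    have := eLpNorm_le_eLpNorm_mul_rpow_measure_univ (p := 1) (q := 2) one_le_two hD.1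
    rwa [ENNReal.toReal_one, ENNReal.toReal_ofNat, show (1 / 1 - 1 / 2 : ℝ) = 1 / 2 by norm_num]
      at this
  rw [eLpNorm_comp_measurePreserving (p := 2) ((hF s).sub hA).1 hmp] at h3
  simp only [h1]
  refine h2.trans ?_
  rw [mul_assoc]
  exact mul_le_mul_right h3 _

/-- On a compact box mean-square convergence implies convergence of integrals against a continuous
kernel, hence convergence at every `z`. -/
theorem tendsto_twistedConvTrunc {τp : ℝ} (hτ : 0 < τp) {r : ℝ → ℂ} (hr : MemLp r 2)
    {w A : ℝ × ℝ → ℂ} (hw : Continuous w) (hA : IsZakTransform τp r A) (R z : ℝ × ℝ) :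
    Tendsto (fun s => twistedConvTrunc w (zakSum τp r s) R z) atTop
      (𝓝 (twistedConvTrunc w A R z)) := by
  have hQ : IsCompact (Set.Icc (-R.1) R.1 ×ˢ Set.Icc (-R.2) R.2) :=
    isCompact_Icc.prod isCompact_Icc
  have hQ' : IsCompact ((fun z' => z - z') ⁻¹' (Set.Icc (-R.1) R.1 ×ˢ Set.Icc (-R.2) R.2)) := by
    have := hQ.image (f := fun z' => z - z') (by fun_prop)
    rwa [Set.image_eq_preimage_of_inverse (fun z' => sub_sub_cancel z z')
      (fun z' => sub_sub_cancel z z')] at this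
  have heq : ∀ F : ℝ × ℝ → ℂ, twistedConvTrunc w F R z =
      ∫ z' in Set.Icc (-R.1) R.1 ×ˢ Set.Icc (-R.2) R.2,
        (w z' * cis (z'.2 * (z.1 - z'.1))) * F (z - z') := fun F => by
    rw [twistedConvTrunc]
    congr 1; ext z'; ring
  have hlim : Tendsto (fun s => eLpNorm (zakSum τp r s - A) 2 (volume.restrict
      ((fun z' => z - z') ⁻¹' (Set.Icc (-R.1) R.1 ×ˢ Set.Icc (-R.2) R.2)))) atTop (𝓝 0) :=
    hA.2 _ hQ'
  have hZ : ∀ s, MemLp (zakSum τp r s) 2 (volume.restrict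
      ((fun z' => z - z') ⁻¹' (Set.Icc (-R.1) R.1 ×ˢ Set.Icc (-R.2) R.2))) := fun s => by
    obtain ⟨L, hL⟩ := hQ'.exists_subset_zakBox hτ
    exact (memLp_zakSum_zakBox hτ hr s L).mono_measure (Measure.restrict_mono_set _ hL)
  have hA2 : MemLp A 2 (volume.restrict
      ((fun z' => z - z') ⁻¹' (Set.Icc (-R.1) R.1 ×ˢ Set.Icc (-R.2) R.2))) := by
    obtain ⟨s, hs⟩ := (hlim.eventually_lt_const ENNReal.zero_lt_top).exists
    have h := (hZ s).sub (⟨(hZ s).1.sub hA.1.restrict, hs⟩ : MemLp (zakSum τp r s - A) 2 _)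
    simpa using h
  simp only [heq]
  exact tendsto_setIntegral_mul_comp_sub hQ (by fun_prop) z hZ hA2 hlim

/-! ### The output of the twisted convolution -/

/-- The Zak transform of a signal of bounded support, as a locally finite sum. -/
noncomputable def zakFull (τp : ℝ) (a : ℝ → ℂ) (z : ℝ × ℝ) : ℂ :=
  (Real.sqrt τp : ℂ) * ∑' n : ℤ, a (z.1 + n * τp) * cis (-(n * z.2 * τp))

/-- If `|τ| ≤ Lτp` with `τ < Lτp`, then `0 ≤ τ + nτp < Nτp` forces `-L < n < N + L`. -/
theorem zakFull_eq_zakSum {τp : ℝ} (hτ : 0 < τp) {a : ℝ → ℂ} {N : ℕ}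
    (ha : ∀ t, t ∉ Set.Ico 0 (N * τp) → a t = 0) {L : ℕ} {s : Finset ℤ}
    (hs : Finset.Ioo (-(L : ℤ)) (N + L) ⊆ s) {z : ℝ × ℝ}
    (hz : z.1 ∈ Set.Ico (-(L * τp)) (L * τp)) : zakFull τp a z = zakSum τp a s z := by
  rw [zakFull, zakSum, tsum_eq_sum fun n hn => ?_]
  rw [ha, zero_mul]
  rintro ⟨h1, h2⟩
  refine hn (hs (Finset.mem_Ioo.2 ⟨?_, ?_⟩))
  · have : (-(L : ℝ)) < n := by
      by_contra! h
      nlinarith [hz.2]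
    exact_mod_cast this
  · have : (n : ℝ) < N + L := by
      by_contra! h
      nlinarith [hz.1]
    exact_mod_cast this

theorem tendsto_Icc_neg_natCast :
    Tendsto (fun n : ℕ => Finset.Icc (-(n : ℤ)) n) atTop atTop := by
  refine tendsto_atTop_finset_of_monotone (fun a b h => Finset.Icc_subset_Icc (by omega) (by omega))
    fun x => ⟨x.natAbs, Finset.mem_Icc.2 ⟨by omega, by omega⟩⟩

theorem tendsto_zakSum_zakFull {τp : ℝ} (hτ : 0 < τp) {a : ℝ → ℂ} {N : ℕ}
    (ha : ∀ t, t ∉ Set.Ico 0 (N * τp) → a t = 0) (z : ℝ × ℝ) :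
    Tendsto (fun n : ℕ => zakSum τp a (Finset.Icc (-(n : ℤ)) n) z) atTop (𝓝 (zakFull τp a z)) := by
  obtain ⟨L, hL⟩ := (isCompact_singleton (x := z)).exists_subset_zakBox hτ
  refine tendsto_const_nhds.congr' ?_
  filter_upwards [tendsto_Icc_neg_natCast.eventually_ge_atTop (Finset.Ioo (-(L : ℤ)) (N + L))]
    with n hn
  exact zakFull_eq_zakSum hτ ha hn (hL rfl).1

theorem delayRightContinuous_zakFull {τp : ℝ} (hτ : 0 < τp) {a : ℝ → ℂ} {N : ℕ}
    (ha : ∀ t, t ∉ Set.Ico 0 (N * τp) → a t = 0)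
    (hc : ∀ t, ContinuousWithinAt a (Set.Ici t) t) : DelayRightContinuous (zakFull τp a) := by
  intro z
  obtain ⟨L, hL⟩ := exists_nat_gt (|z.1| / τp)
  rw [div_lt_iff₀ hτ, abs_lt] at hL
  have heq : zakFull τp a =ᶠ[𝓝 z] zakSum τp a (Finset.Ioo (-(L : ℤ)) (N + L)) := by
    have hU : ∀ᶠ z' : ℝ × ℝ in 𝓝 z, z'.1 ∈ Set.Ioo (-(L * τp)) (L * τp) :=
      continuous_fst.continuousAt.eventually (Ioo_mem_nhds hL.1 hL.2)
    filter_upwards [hU] with z' hz'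
    exact zakFull_eq_zakSum hτ ha subset_rfl (Set.Ioo_subset_Ico_self hz')
  refine ContinuousWithinAt.congr_of_eventuallyEq ?_ (heq.filter_mono nhdsWithin_le_nhds)
    heq.eq_of_nhds
  unfold zakSum
  refine continuousWithinAt_const.mul (tendsto_finsetSum _ fun n _ => ?_)
  refine ContinuousWithinAt.mul ?_ (Continuous.continuousWithinAt (by fun_prop))
  exact (hc (z.1 + n * τp)).comp (f := fun z' : ℝ × ℝ => z'.1 + n * τp)
    (Continuous.continuousWithinAt (by fun_prop))
    fun z' hz' => add_le_add_left (Set.mem_Ici.1 hz'.1) _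

/-- Every `z` is a limit of points of larger delay at which `C` and `D` agree. -/
theorem DelayRightContinuous.eq_of_ae_eq {C D : ℝ × ℝ → ℂ} (hC : DelayRightContinuous C)
    (hD : DelayRightContinuous D) (h : C =ᵐ[volume] D) : C = D := by
  ext z
  have hdense : Dense {z' | C z' = D z'} := Measure.dense_of_ae h
  have hopen : IsOpen (Set.Ioi z.1 ×ˢ (Set.univ : Set ℝ)) := isOpen_Ioi.prod isOpen_univ
  have hz : z ∈ closure (Set.Ioi z.1 ×ˢ (Set.univ : Set ℝ) ∩ {z' | C z' = D z'}) := by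
    refine closure_minimal (hdense.open_subset_closure_inter hopen) isClosed_closure ?_
    rw [closure_prod_eq, closure_Ioi]
    exact ⟨Set.mem_Ici.2 le_rfl, by simp⟩
  have hne := mem_closure_iff_nhdsWithin_neBot.1 hz
  have hsub : Set.Ioi z.1 ×ˢ (Set.univ : Set ℝ) ∩ {z' | C z' = D z'} ⊆
      Set.Ici z.1 ×ˢ Set.univ := fun z' hz' => ⟨(Set.mem_Ioi.1 hz'.1.1).le, trivial⟩
  refine tendsto_nhds_unique ((hC z).mono hsub) (((hD z).mono hsub).congr' ?_)
  filter_upwards [self_mem_nhdsWithin] with z' hz' using hz'.2.symm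

theorem continuousWithinAt_W4 (T t : ℝ) : ContinuousWithinAt (W4 T) (Set.Ici t) t := by
  have key : ∀ c : ℂ, (∀ᶠ s in 𝓝[≥] t, W4 T s = c) → ContinuousWithinAt (W4 T) (Set.Ici t) t :=
    fun c hc => (continuousWithinAt_const (b := c)).congr_of_eventuallyEq hc
      (hc.self_of_nhdsWithin (Set.mem_Ici.2 le_rfl))
  rcases lt_or_ge t 0 with h0 | h0
  · refine key 0 ?_
    filter_upwards [nhdsWithin_le_nhds (Iio_mem_nhds h0)] with s hs
    exact Set.indicator_of_notMem (fun h => absurd h.1 (not_le.2 hs)) _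
  rcases lt_or_ge t T with h1 | h1
  · refine key (1 / Real.sqrt T : ℝ) ?_
    filter_upwards [nhdsWithin_le_nhds (Iio_mem_nhds h1), self_mem_nhdsWithin] with s hs hs'
    exact Set.indicator_of_mem (s := Set.Ico 0 T) ⟨h0.trans hs', hs⟩ _
  · refine key 0 ?_
    filter_upwards [self_mem_nhdsWithin] with s hs
    exact Set.indicator_of_notMem (fun h => absurd h.2 (not_lt.2 (h1.trans hs))) _

theorem rxSignal_eq_zero (B T : ℝ) (r : ℝ → ℂ) {t : ℝ} (ht : t ∉ Set.Ico 0 T) :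
    rxSignal B T r t = 0 := by
  rw [rxSignal_eq, W4, Set.indicator_of_notMem ht, zero_mul]

theorem zakSum_sub (τp : ℝ) (a b : ℝ → ℂ) (s : Finset ℤ) :
    zakSum τp (a - b) s = zakSum τp a s - zakSum τp b s := by
  ext z
  simp only [zakSum, Pi.sub_apply, sub_mul, Finset.sum_sub_distrib, mul_sub]

theorem continuous_wrx (B T : ℝ) : Continuous (wrx B T) := by unfold wrx; fun_prop

theorem tendsto_zakSum_truncSignal {B T τp : ℝ} (hτ : 0 < τp) {r : ℝ → ℂ} (hr : MemLp r 2)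
    {A : ℝ × ℝ → ℂ} (hA : IsZakTransform τp r A) {R : ℝ × ℝ} (hR : 0 ≤ R.2) (z : ℝ × ℝ) :
    Tendsto (fun n : ℕ => zakSum τp (truncSignal B T r R) (Finset.Icc (-(n : ℤ)) n) z) atTop
      (𝓝 (twistedConvTrunc (wrx B T) A R z)) := by
  simp only [← twistedConvTrunc_zakSum τp hr _ hR]
  exact (tendsto_twistedConvTrunc hτ hr (continuous_wrx B T) hA R z).comp tendsto_Icc_neg_natCast

/-- The error is a pointwise limit of partial Zak sums of `truncSignal - rxSignal`. Fatou and the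
uniform bound on partial sums control it by `2L` times the `L²` distance of the two signals. -/
theorem isTwistedConv_zakFull {B T τp : ℝ} (hB : 0 < B) (hT : 0 < T) (hτ : 0 < τp) {N : ℕ}
    (hN : T = N * τp) {r : ℝ → ℂ} (hr : MemLp r 2) {A : ℝ × ℝ → ℂ} (hA : IsZakTransform τp r A) :
    IsTwistedConv (wrx B T) A (zakFull τp (rxSignal B T r)) := by
  have hsupp : ∀ t, t ∉ Set.Ico 0 (N * τp) → rxSignal B T r t = 0 := fun t ht =>
    rxSignal_eq_zero B T r (hN ▸ ht)
  have hym := aestronglyMeasurable_rxSignal (T := T) hB hr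
  refine ⟨aestronglyMeasurable_of_tendsto_ae atTop
    (fun n : ℕ => aestronglyMeasurable_zakSum τp hym (Finset.Icc (-(n : ℤ)) n))
    (ae_of_all _ fun z => tendsto_zakSum_zakFull hτ hsupp z), fun S hS => ?_⟩
  obtain ⟨L, hL⟩ := hS.exists_subset_zakBox hτ
  have hup := ENNReal.Tendsto.const_mul (a := 2 * (L : ENNReal)) (tendsto_truncSignal hB hT hr)
    (Or.inr (by finiteness))
  rw [mul_zero] at hup
  refine tendsto_of_tendsto_of_tendsto_of_le_of_le' tendsto_const_nhds hup
    (Eventually.of_forall fun _ => zero_le) ?_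
  filter_upwards [tendsto_snd.eventually_ge_atTop (0 : ℝ)] with R hR
  refine (eLpNorm_mono_measure _ (Measure.restrict_mono_set _ hL)).trans ?_
  have hm := (aestronglyMeasurable_truncSignal hB hT hr R).sub hym
  refine eLpNorm_le_of_tendsto
    (f := fun n : ℕ => zakSum τp (truncSignal B T r R - rxSignal B T r) (Finset.Icc (-(n : ℤ)) n))
    (fun n => (aestronglyMeasurable_zakSum τp hm _).restrict) (ae_of_all _ fun z => ?_)
    (Eventually.of_forall fun n => eLpNorm_zakSum_le hτ L hm _) tendsto_const_nhds
  simp only [zakSum_sub, Pi.sub_apply]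
  exact (tendsto_zakSum_truncSignal hτ hr hA hR z).sub (tendsto_zakSum_zakFull hτ hsupp z)

theorem IsTwistedConv.ae_eq_zakFull {B T τp : ℝ} (hB : 0 < B) (hT : 0 < T) (hτ : 0 < τp) {N : ℕ}
    (hN : T = N * τp) {r : ℝ → ℂ} (hr : MemLp r 2) {A C : ℝ × ℝ → ℂ} (hA : IsZakTransform τp r A)
    (hC : IsTwistedConv (wrx B T) A C) : C =ᵐ[volume] zakFull τp (rxSignal B T r) := by
  have hF := isTwistedConv_zakFull hB hT hτ hN hr hA
  rw [← Measure.restrict_univ (μ := (volume : Measure (ℝ × ℝ))), ← iUnion_zakBox hτ, EventuallyEq,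
    ae_restrict_iUnion_iff]
  intro L
  obtain ⟨S, hS, hLS⟩ := zakBox_subset_isCompact τp L
  refine ae_restrict_of_ae_restrict_of_subset hLS ?_
  refine ae_eq_of_tendsto_eLpNorm_sub ?_ hC.1.restrict hF.1.restrict (hC.2 S hS) (hF.2 S hS)
  filter_upwards [tendsto_snd.eventually_ge_atTop (0 : ℝ)] with R hR
  exact (aestronglyMeasurable_of_tendsto_ae atTop (fun n : ℕ => aestronglyMeasurable_zakSum τp
    (aestronglyMeasurable_truncSignal hB hT hr R) (Finset.Icc (-(n : ℤ)) n))
    (ae_of_all _ fun z => tendsto_zakSum_truncSignal hτ hr hA hR z)).restrict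

/-- Every admissible choice of Zak transform and twisted convolution leads to the same
right-continuous function, and at least one choice exists. -/
theorem isZakOtfsDemod_iff {B T τp : ℝ} (hB : 0 < B) (hT : 0 < T) (hτ : 0 < τp) {N : ℕ}
    (hN : T = N * τp) {r : ℝ → ℂ} (hr : MemLp r 2) (ydd : ℤ → ℤ → ℂ) :
    IsZakOtfsDemod B T τp (wrx B T) r ydd ↔
      ∀ k l : ℤ, ydd k l = zakFull τp (rxSignal B T r) ((k : ℝ) / B, (l : ℝ) / T) := by
  have hcont : DelayRightContinuous (zakFull τp (rxSignal B T r)) :=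
    delayRightContinuous_zakFull hτ (fun t ht => rxSignal_eq_zero B T r (hN ▸ ht)) fun t =>
      (continuousWithinAt_W4 T t).mul
        (continuous_conv (memLp_w3 hB T) hr).continuousWithinAt
  constructor
  · rintro ⟨A, C, hA, hC, hCc, h⟩
    rwa [hCc.eq_of_ae_eq hcont (hC.ae_eq_zakFull hB hT hτ hN hr hA)] at h
  · intro h
    obtain ⟨A, hA⟩ := exists_isZakTransform hτ hr
    exact ⟨A, _, hA, isTwistedConv_zakFull hB hT hτ hN hr hA, hcont, h⟩

/-! ### Samples on the information lattice -/

theorem cis_eq_one_iff (x : ℝ) : cis x = 1 ↔ ∃ n : ℤ, x = n := by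
  constructor
  · intro h
    obtain ⟨n, hn⟩ := Complex.exp_eq_one_iff.1 h
    refine ⟨n, ?_⟩
    have h1 : (2 * Real.pi * Complex.I : ℂ) * x = (2 * Real.pi * Complex.I) * n := by
      linear_combination hn
    exact_mod_cast mul_left_cancel₀ Complex.two_pi_I_ne_zero h1
  · rintro ⟨n, rfl⟩; exact cis_intCast n

theorem cis_natCast_mul (p : ℕ) (x : ℝ) : cis (p * x) = cis x ^ p := by
  rw [cis, cis, ← Complex.exp_nat_mul]; congr 1; push_cast; ring

theorem sum_cis_range {M : ℕ} (hM : 0 < M) (j : ℤ) :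
    ∑ p ∈ Finset.range M, cis (p * (j / M)) = if (M : ℤ) ∣ j then (M : ℂ) else 0 := by
  have hM' : (M : ℝ) ≠ 0 := by positivity
  have hiff : cis (j / M : ℝ) = 1 ↔ (M : ℤ) ∣ j := by
    rw [cis_eq_one_iff]
    refine exists_congr fun n => ?_
    rw [div_eq_iff hM']
    exact_mod_cast (by rw [mul_comm] : j = n * (M : ℤ) ↔ j = M * n)
  simp only [cis_natCast_mul]
  split_ifs with h
  · simp [hiff.2 h]
  · have h1 := mt hiff.1 h
    rw [geom_sum_eq h1, ← cis_natCast_mul, mul_div_cancel₀ _ hM', cis_intCast]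
    simp

/-- The DFZT of the DFT selects one residue class of samples. -/
theorem dfzt_dft {M N : ℕ} (hM : 0 < M) (hN : 0 < N) (y : ℤ → ℂ) (k l : ℤ) :
    dfzt M N (dft (M * N) y) k l = (1 / Real.sqrt N : ℝ) * ∑ m ∈ Finset.range (M * N),
      if (M : ℤ) ∣ k - m then y m * cis (l * (k - m) / (M * N)) else 0 := by
  have hM' : (M : ℝ) ≠ 0 := by positivity
  have hN' : (N : ℝ) ≠ 0 := by positivity
  -- The phase depends on `p` only through `p(k - m)/M`, so summing over `p` gives `M` or `0`; that
  -- `M` enters the constant below.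
  have h1 : ∀ p m : ℕ, (y m * cis (-((m : ℝ) * ((l + p * N : ℤ) : ℝ) / ((M * N : ℕ) : ℝ)))) *
      cis (((l : ℝ) + p * N) * k / (M * N)) =
      (y m * cis (l * (k - m) / (M * N))) * cis (p * (((k - m : ℤ) : ℝ) / M)) := fun p m => by
    rw [mul_assoc, mul_assoc, ← cis_add, ← cis_add]
    congr 2
    push_cast
    field_simp
    ring
  have hconst : (1 / Real.sqrt M) * (1 / Real.sqrt (M * N : ℕ)) * M = 1 / Real.sqrt N := by
    have hs := Real.mul_self_sqrt (show (0 : ℝ) ≤ M by positivity)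
    have h0 : Real.sqrt M ≠ 0 := (Real.sqrt_pos.2 (by positivity)).ne'
    have h0' : Real.sqrt N ≠ 0 := (Real.sqrt_pos.2 (by positivity)).ne'
    rw [Nat.cast_mul, Real.sqrt_mul (by positivity)]
    field_simp
    rw [pow_two, hs]
  simp only [dfzt, dft]
  rw [← hconst]
  push_cast
  rw [mul_assoc, mul_assoc]
  congr 1
  have h2 : ∀ p : ℕ, (1 / (Real.sqrt (M * N : ℝ) : ℂ) * ∑ m ∈ Finset.range (M * N), y m *
      cis (-((m : ℝ) * (l + p * N) / (M * N)))) * cis (((l : ℝ) + p * N) * k / (M * N)) =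
      1 / (Real.sqrt (M * N : ℝ) : ℂ) * ∑ m ∈ Finset.range (M * N),
        (y m * cis (l * (k - m) / (M * N))) * cis (p * (((k - m : ℤ) : ℝ) / M)) := fun p => by
    rw [mul_assoc, Finset.sum_mul]
    congr 1
    refine Finset.sum_congr rfl fun m _ => ?_
    rw [← h1]
    push_cast; rfl
  simp only [h2]
  rw [← Finset.mul_sum, Finset.sum_comm]
  congr 1
  simp only [← Finset.mul_sum, sum_cis_range hM]
  rw [Finset.mul_sum]
  refine Finset.sum_congr rfl fun m _ => ?_
  split_ifs <;> ring

theorem rxSample_eq_zero {B T : ℝ} {K : ℕ} (hB : 0 < B) (hBT : B * T = K) (r : ℝ → ℂ) {n : ℤ}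
    (hn : ¬ (0 ≤ n ∧ n < K)) : rxSample B T r n = 0 := by
  rw [rxSample, rxSignal_eq_zero, mul_zero]
  rintro ⟨h1, h2⟩
  refine hn ⟨?_, ?_⟩
  · have := mul_nonneg h1 hB.le
    rw [div_mul_cancel₀ _ hB.ne'] at this
    exact_mod_cast this
  · rw [div_lt_iff₀ hB, mul_comm, hBT] at h2
    exact_mod_cast h2

/-- The substitution `m = k + nM` runs through the residue class of `k` modulo `M`, and the support
of `y` reduces it to one block of length `MN`. -/
theorem tsum_sample_eq_sum {M N : ℕ} (hM : 0 < M) (hN : 0 < N) {y : ℤ → ℂ}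
    (hy : ∀ n : ℤ, ¬ (0 ≤ n ∧ n < ((M * N : ℕ) : ℤ)) → y n = 0) (k l : ℤ) :
    ∑' n : ℤ, y (k + n * M) * cis (-(n * l / N)) = ∑ m ∈ Finset.range (M * N),
      if (M : ℤ) ∣ k - m then y m * cis (l * (k - m) / (M * N)) else 0 := by
  have hM' : (M : ℝ) ≠ 0 := by positivity
  have hN' : (N : ℝ) ≠ 0 := by positivity
  set g : ℤ → ℂ := fun m => if (M : ℤ) ∣ k - m then y m * cis (l * (k - m) / (M * N)) else 0
    with hg
  have h1 : ∀ n : ℤ, y (k + n * M) * cis (-(n * l / N)) = g (k + n * M) := fun n => by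
    have hd : (M : ℤ) ∣ k - (k + n * M) := ⟨-n, by ring⟩
    simp only [hg, if_pos hd]
    congr 2
    push_cast
    field_simp
    ring
  have hinj : Function.Injective fun n : ℤ => k + n * M := fun a b h => by
    simpa [hM.ne'] using h
  have hsupp : Function.support g ⊆ Set.range fun n : ℤ => k + n * M := fun m hm => by
    by_cases hd : (M : ℤ) ∣ k - m
    · obtain ⟨q, hq⟩ := hd
      exact ⟨-q, by simp only; linarith⟩
    · exact absurd (if_neg hd) hm
  simp only [h1]
  rw [hinj.tsum_eq hsupp, tsum_eq_sum (s := (Finset.range (M * N)).map Nat.castEmbedding)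
    fun m hm => ?_, Finset.sum_map]
  · rfl
  · have : y m = 0 := hy m fun ⟨h0, h1⟩ => hm <| by
      refine Finset.mem_map.2 ⟨m.toNat, Finset.mem_range.2 (by omega), ?_⟩
      simp [h0]
    simp [hg, this]

/-- A delay period is `M` sampling intervals, so all shifts of `k/B` stay on the sampling grid. The
factor `√τp = √T/√N` supplies both the `√T` in `rxSample` and the `1/√N` of the selected residue
class. -/
theorem zakFull_rxSignal {B T : ℝ} (hB : 0 < B) (hT : 0 < T) {M N : ℕ} (hM : 0 < M) (hN : 0 < N)
    (hBT : B * T = (M * N : ℕ)) (r : ℝ → ℂ) (k l : ℤ) :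
    zakFull (M / B) (rxSignal B T r) ((k : ℝ) / B, (l : ℝ) / T) =
      dfzt M N (cpOfdmDemod (M * N) B T r) k l := by
  have hM' : (M : ℝ) ≠ 0 := by positivity
  have hN' : (N : ℝ) ≠ 0 := by positivity
  have hBT' : B * T = M * N := by exact_mod_cast hBT
  rw [cpOfdmDemod, dfzt_dft hM hN, ← tsum_sample_eq_sum hM hN
    (fun n hn => rxSample_eq_zero hB hBT r hn), zakFull, ← tsum_mul_left, ← tsum_mul_left]
  congr 1; ext n
  have e1 : (k : ℝ) / B + n * (M / B) = ((k + n * M : ℤ) : ℝ) / B := by push_cast; ring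
  have e2 : (n : ℝ) * (l / T) * (M / B) = n * l / N := by
    field_simp
    linear_combination (-(n : ℝ) * l) * hBT'
  have e3 : Real.sqrt (M / B) = 1 / Real.sqrt N * Real.sqrt T := by
    have : (M : ℝ) / B = 1 / N * T := by
      field_simp
      linarith
    rw [this, Real.sqrt_mul (by positivity), Real.sqrt_div zero_le_one, Real.sqrt_one]
  simp only [rxSample, e1, e2, e3]
  push_cast
  ring

theorem theorem2 (K M N : ℕ) (hM : 0 < M) (hN : 0 < N) (hK : M * N = K)
    (Δf T B : ℝ) (hΔf : 0 < Δf) (hT : T = 1 / Δf) (hB : B = K * Δf) :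
    -- the corresponding delay and Doppler periods
    (∀ τp νp : ℝ, (τp * νp = 1 ∧ B * τp = M ∧ T * νp = N) ↔
      (νp = N / T ∧ νp = N * Δf ∧ τp = 1 / νp ∧ τp = M / B)) ∧
    ∀ r : ℝ → ℂ, MemLp r 2 volume →
      -- the windowed signal lives on `[0, T)`, so that periodization changes nothing
      (∀ t : ℝ, t ∉ Set.Ico 0 T → rxSignal B T r t = 0) ∧
      (∀ n : ℤ, 0 ≤ n → n < K →
        HasSum (fun p : ℤ => rxSample B T r (n + p * (M * N))) (rxSample B T r n)) ∧
      -- the Zak-OTFS demodulator has exactly one output: the DFZT of the CP-OFDM output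
      (∀ ydd : ℤ → ℤ → ℂ,
        IsZakOtfsDemod B T (M / B) (wrx B T) r ydd ↔
          ydd = dfzt M N (cpOfdmDemod K B T r)) := by
  subst hK
  have hM' : (0 : ℝ) < M := by exact_mod_cast hM
  have hN' : (0 : ℝ) < N := by exact_mod_cast hN
  have hTpos : 0 < T := by rw [hT]; positivity
  have hBpos : 0 < B := by rw [hB]; push_cast; positivity
  have hTΔ : T * Δf = 1 := by rw [hT]; field_simp
  have hBT : B * T = (M * N : ℕ) := by rw [hB, mul_assoc, mul_comm Δf, hTΔ, mul_one]
  have hBT' : B * T = M * N := by exact_mod_cast hBT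
  refine ⟨fun τp νp => ⟨?_, ?_⟩, fun r hr => ⟨fun t ht => rxSignal_eq_zero B T r ht, ?_, ?_⟩⟩
  · rintro ⟨h1, h2, h3⟩
    have hν : νp ≠ 0 := right_ne_zero_of_mul_eq_one h1
    have h4 : νp = N / T := by rw [eq_div_iff hTpos.ne', mul_comm, h3]
    refine ⟨h4, ?_, by rwa [eq_div_iff hν], by rw [eq_div_iff hBpos.ne', mul_comm, h2]⟩
    rw [h4, hT]; field_simp
  · rintro ⟨h1, -, h3, h4⟩
    have hν : νp ≠ 0 := by rw [h1]; positivity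
    exact ⟨by rw [h3]; field_simp, by rw [h4]; field_simp, by rw [h1]; field_simp⟩
  · intro n h0 h1
    have := hasSum_single (f := fun p : ℤ => rxSample B T r (n + p * (M * N))) 0 fun p hp => by
      refine rxSample_eq_zero hBpos hBT r fun ⟨h2, h3⟩ => hp ?_
      push_cast at h1 h3
      have hK : (0 : ℤ) < M * N := by positivity
      have h4 : p < 1 := by
        by_contra! h
        nlinarith
      have h5 : -1 < p := by
        by_contra! h
        nlinarith
      omega
    simpa using this
  · intro ydd
    have hτ : 0 < M / B := by positivity
    have hTN : T = N * (M / B) := by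
      field_simp
      linarith
    rw [isZakOtfsDemod_iff hBpos hTpos hτ hTN hr]
    simp only [zakFull_rxSignal hBpos hTpos hM hN hBT]
    exact ⟨fun h => by ext k l; exact h k l, fun h k l => by rw [h]⟩
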